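/- Let $\alpha>-1$, let $dA$ be Lebesgue area measure on the unit disc $\mathbb D$ normalised so that $\mathbb D$ has measure $1$, and put $\omega_\alpha(z)=(1+\alpha)(1-|z|^2)^\alpha$. Let $L^2_h(\omega_\alpha)$ be the closed subspace of the complex Hilbert space $L^2(\omega_\alpha)=L^2(\mathbb D,\omega_\alpha dA)$ consisting of the complex-valued functions that are harmonic on $\mathbb D$. For $z,\lambda\in\mathbb D$ let $$K^\alpha_z(\lambda)=\frac{1}{(1-\overline z\lambda)^{2+\alpha}},\qquad R^\alpha_z(\lambda)=K^\alpha_z(\lambda)+\overline{K^\alpha_z(\lambda)}-1 ,$$ the latter being the reproducing kernel of $L^2_h(\omega_\alpha)$. For $\varphi\in L^\infty(\omega_\alpha)$ let $T_\varphi f=P(\varphi f)$ be the Toeplitz operator on $L^2_h(\omega_\alpha)$, where $P$ is the orthogonal projection of $L^2(\omega_\alpha)$ onto $L^2_h(\omega_\alpha)$, and let $$\widetilde\varphi(z)=\frac{1}{\|R^\alpha_z\|^2_{L^2(\omega_\alpha)}}\int_{\mathbb D}\varphi(\lambda)\,|R^\alpha_z(\lambda)|^2\,\omega_\alpha(\lambda)\,dA(\lambda),\qquad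 z\in\mathbb D,$$ be the Berezin transform of $\varphi$. Then $$\|R^\alpha_z\|^2_{L^2(\omega_\alpha)}=R^\alpha_z(z)=\frac{2}{(1-|z|^2)^{2+\alpha}}-1\qquad\text{for all } z\in\mathbb D,$$ and for every $\varphi\in L^\infty(\omega_\alpha)$ with $\varphi\ge 0$ the following conditions are equivalent: (1) $T_\varphi$ is invertible on $L^2_h(\omega_\alpha)$ (it has a bounded inverse). (2) $\widetilde\varphi$ is invertible in the algebra $L^\infty(\omega_\alpha)$. (3) There is $r>0$ such that, with $G=\{z\in\mathbb D:\varphi(z)>r\}$, the measure $\chi_G\,dA$ is a reverse Carleson measure for $L^2_h(\omega_\alpha)$, that is, there is $C>0$ with $$\int_{\mathbb D}|f|^2\omega_\alpha\,dA\le C\int_G|f|^2\omega_\alpha\,dA\qquad\text{for all } f\in L^2_h(\omega_\alpha).$$ (4) There is $C>0$ such that $$\int_{\mathbb D}|f|^2\varphi\,\omega_\alpha\,dA\ge C\int_{\mathbb D}|f|^2\omega_\alpha\,dA\qquad\text{for all } f\in L^2_h(\omega_\alpha).$$ -/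

import Mathlib

open MeasureTheory InnerProductSpace Filter Topology
open scoped ENNReal ComplexConjugate

namespace HarmonicBergman

theorem harmonic_of_uniform_limit_real {u : ℕ → ℂ → ℝ} {v : ℂ → ℝ} {R : ℝ} (hR : 0 < R)
    (hu : ∀ n, HarmonicOnNhd (u n) (Metric.closedBall 0 R))
    (hlim : TendstoUniformlyOn u v atTop (Metric.closedBall 0 R)) :
    HarmonicOnNhd v (Metric.ball 0 R) := by
  have hsph : Metric.sphere (0 : ℂ) |R| ⊆ Metric.closedBall 0 R := by
    rw [abs_of_pos hR]; exact Metric.sphere_subset_closedBall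
  have hv : ContinuousOn v (Metric.closedBall 0 R) :=
    hlim.continuousOn (Eventually.of_forall fun n => (hu n).continuousOn).frequently
  have hvi : CircleIntegrable v 0 R := (hv.mono hsph).circleIntegrable'
  have hvi' : CircleIntegrable (fun z => (v z : ℂ)) 0 R :=
    (Complex.continuous_ofReal.comp_continuousOn (hv.mono hsph)).circleIntegrable'
  -- Poisson formula for the limit
  have hP : ∀ w ∈ Metric.ball (0 : ℂ) R,
      Real.circleAverage ((Complex.re ∘ herglotzRieszKernel 0 w) • v) 0 R = v w := by
    intro w hw
    have hk : ContinuousOn (Complex.re ∘ herglotzRieszKernel 0 w) (Metric.sphere 0 |R|) :=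
      Complex.continuous_re.comp_continuousOn (continuousOn_herglotzRieszKernel_sphere hw)
    obtain ⟨M, hM⟩ := (isCompact_sphere (0 : ℂ) |R|).exists_bound_of_continuousOn hk
    have h1 : Tendsto (fun n => Real.circleAverage
        ((Complex.re ∘ herglotzRieszKernel 0 w) • u n) 0 R) atTop
        (𝓝 (Real.circleAverage ((Complex.re ∘ herglotzRieszKernel 0 w) • v) 0 R)) := by
      unfold Real.circleAverage
      refine Tendsto.const_smul ?_ _
      apply TendstoUniformlyOn.tendsto_intervalIntegral_of_continuousOn
      · refine Eventually.of_forall fun n => ?_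
        have : ContinuousOn ((Complex.re ∘ herglotzRieszKernel 0 w) • u n)
            (Metric.sphere 0 |R|) := hk.smul ((hu n).continuousOn.mono hsph)
        exact this.comp (continuous_circleMap 0 R).continuousOn
          fun θ _ => circleMap_mem_sphere' 0 R θ
      · rw [Metric.tendstoUniformlyOn_iff] at hlim ⊢
        intro ε hε
        have hM1 : 0 < |M| + 1 := by positivity
        filter_upwards [hlim (ε / (|M| + 1)) (by positivity)] with n hn θ _
        have hmem := circleMap_mem_sphere' 0 R θ
        have h2 := hn _ (hsph hmem)
        have h3 := hM _ hmem
        rw [Real.dist_eq] at h2 ⊢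
        simp only [Pi.smul_apply', smul_eq_mul]
        rw [← mul_sub, abs_mul]
        rw [Real.norm_eq_abs] at h3
        calc _ ≤ |M| * |v (circleMap 0 R θ) - u n (circleMap 0 R θ)| := by
              exact mul_le_mul_of_nonneg_right (h3.trans (le_abs_self M)) (abs_nonneg _)
          _ ≤ (|M| + 1) * |v (circleMap 0 R θ) - u n (circleMap 0 R θ)| := by
              gcongr; linarith
          _ < (|M| + 1) * (ε / (|M| + 1)) := by gcongr
          _ = ε := by field_simp
    have h2 : ∀ n, Real.circleAverage ((Complex.re ∘ herglotzRieszKernel 0 w) • u n) 0 R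
        = u n w := fun n => (hu n).circleAverage_re_herglotzRieszKernel_smul hw
    simp only [h2] at h1
    exact tendsto_nhds_unique h1 (hlim.tendsto_at (Metric.ball_subset_closedBall hw))
  -- the limit is the real part of a Cauchy integral
  lift R to NNReal using hR.le
  have hps := hasFPowerSeriesOn_cauchy_integral hvi' (by exact_mod_cast hR)
  set G : ℂ → ℂ := fun w =>
    (2 * Real.pi * Complex.I : ℂ)⁻¹ • ∮ z in C(0, (R : ℝ)), (z - w)⁻¹ • (v z : ℂ) with hG
  have hEq : ∀ w ∈ Metric.ball (0 : ℂ) R,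
      v w = (2 * G w - ((Real.circleAverage v 0 R : ℝ) : ℂ)).re := by
    intro w hw
    rw [← hP w hw, ← re_circleAverage_herglotzRieszKernel_smul hvi hw]
    congr 1
    have hker : ContinuousOn (fun ζ : ℂ => (ζ - w)⁻¹) (Metric.sphere 0 |(R : ℝ)|) := by
      apply ContinuousOn.inv₀ (by fun_prop)
      intro x hx h0
      rw [sub_eq_zero] at h0
      subst h0
      simp at hx hw
      rw [hx] at hw
      exact lt_irrefl _ hw
    have e1 : G w = Real.circleAverage (fun ζ : ℂ => ζ * ((ζ - w)⁻¹ * (v ζ : ℂ))) 0 R := by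
      rw [Real.circleAverage_eq_circleIntegral hR.ne', hG]
      simp only [sub_zero, smul_eq_mul]
      congr 1
      apply circleIntegral.integral_congr R.2
      intro z hz
      have : z ≠ 0 := by
        rintro rfl
        simp at hz
        exact hR.ne' (by exact_mod_cast hz.symm)
      field_simp
    have e2 : ((Real.circleAverage v 0 R : ℝ) : ℂ) = Real.circleAverage (fun ζ => (v ζ : ℂ)) 0 R :=
      (Complex.ofRealCLM.circleAverage_comp_comm hvi).symm
    have hi : CircleIntegrable (fun ζ : ℂ => ζ * ((ζ - w)⁻¹ * (v ζ : ℂ))) 0 R := by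
      apply ContinuousOn.circleIntegrable'
      exact continuousOn_id.mul (hker.mul
        (Complex.continuous_ofReal.comp_continuousOn (hv.mono hsph)))
    have e3 : (2 : ℂ) * G w = Real.circleAverage
        ((2 : ℂ) • fun ζ : ℂ => ζ * ((ζ - w)⁻¹ * (v ζ : ℂ))) 0 R := by
      rw [Real.circleAverage_smul, e1, smul_eq_mul]
    rw [e3, e2, ← Real.circleAverage_sub (hi.const_smul) hvi']
    apply Real.circleAverage_congr_sphere
    intro z hz
    have hzw : z - w ≠ 0 := by
      intro h0
      rw [sub_eq_zero] at h0
      subst h0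
      simp at hz hw
      rw [hz] at hw
      exact lt_irrefl _ hw
    simp only [herglotzRieszKernel_def, Pi.sub_apply, Pi.smul_apply, smul_eq_mul, sub_zero]
    have hinv : (z - w)⁻¹ * (z - w) = 1 := inv_mul_cancel₀ hzw
    rw [div_mul_eq_mul_div, div_eq_iff hzw]
    linear_combination -2 * z * (v z : ℂ) * hinv
  intro w hw
  have hGa : AnalyticAt ℂ G w := by
    apply hps.analyticAt_of_mem
    rw [Metric.mem_eball, edist_lt_coe]
    rw [Metric.mem_ball] at hw
    exact_mod_cast hw
  have hF : AnalyticAt ℂ (fun w => 2 * G w - ((Real.circleAverage v 0 R : ℝ) : ℂ)) w :=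
    (analyticAt_const.mul hGa).sub analyticAt_const
  refine (harmonicAt_congr_nhds ?_).2 hF.harmonicAt_re
  filter_upwards [Metric.isOpen_ball.mem_nhds hw] with x hx using hEq x hx

theorem harmonic_of_uniform_limit {u : ℕ → ℂ → ℂ} {v : ℂ → ℂ} {R : ℝ} (hR : 0 < R)
    (hu : ∀ n, HarmonicOnNhd (u n) (Metric.closedBall 0 R))
    (hlim : TendstoUniformlyOn u v atTop (Metric.closedBall 0 R)) :
    HarmonicOnNhd v (Metric.ball 0 R) := by
  have hre := harmonic_of_uniform_limit_real hR (fun n => (hu n).comp_CLM Complex.reCLM)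
    (Complex.reCLM.uniformContinuous.comp_tendstoUniformlyOn hlim)
  have him := harmonic_of_uniform_limit_real hR (fun n => (hu n).comp_CLM Complex.imCLM)
    (Complex.imCLM.uniformContinuous.comp_tendstoUniformlyOn hlim)
  have h := (hre.comp_CLM Complex.ofRealCLM).add
    (him.comp_CLM ((ContinuousLinearMap.mul ℝ ℂ Complex.I).comp Complex.ofRealCLM))
  convert h using 1
  ext z
  simp [mul_comm Complex.I, Complex.re_add_im]


theorem enorm_le_lintegral_circle {g : ℂ → ℂ} {c : ℂ} {r : ℝ} (hr : 0 < r)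
    (hg : HarmonicOnNhd g (Metric.closedBall c r)) :
    ENNReal.ofReal (2 * Real.pi) * ‖g c‖ₑ ≤
      ∫⁻ θ in Set.Ioo (-Real.pi) Real.pi, ‖g (c + Complex.polarCoord.symm (r, θ))‖ₑ := by
  have h1 : Real.circleAverage g c r = g c :=
    InnerProductSpace.HarmonicOnNhd.circleAverage_eq (by rwa [abs_of_pos hr])
  rw [Real.circleAverage_eq_integral_add (-Real.pi)] at h1
  have h2 : ((2 * Real.pi : ℝ) : ℂ) * g c =
      ∫ θ in Set.Ioo (-Real.pi) Real.pi, g (c + Complex.polarCoord.symm (r, θ)) := by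
    rw [← h1, ← integral_Ioc_eq_integral_Ioo,
      ← intervalIntegral.integral_of_le (by linarith [Real.pi_pos]),
      intervalIntegral.integral_comp_add_right (fun θ => g (circleMap c r θ))]
    have e : 2 * Real.pi + -Real.pi = Real.pi := by ring
    rw [e, zero_add, Complex.real_smul, ← mul_assoc, ← Complex.ofReal_mul,
      mul_inv_cancel₀ (by positivity), Complex.ofReal_one, one_mul]
    congr 1
    ext θ
    congr 1
    simp [circleMap, Complex.exp_mul_I]
  calc ENNReal.ofReal (2 * Real.pi) * ‖g c‖ₑ = ‖((2 * Real.pi : ℝ) : ℂ) * g c‖ₑ := by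
        have h3 : ‖((2 * Real.pi : ℝ) : ℂ)‖ₑ = ENNReal.ofReal (2 * Real.pi) := by
          rw [← ofReal_norm, Complex.norm_real, Real.norm_eq_abs, abs_of_pos (by positivity)]
        rw [enorm_mul, h3]
    _ ≤ _ := by
        rw [h2]
        exact enorm_integral_le_lintegral_enorm _

theorem enorm_le_lintegral_ball {g : ℂ → ℂ} {c : ℂ} {δ : ℝ} (hδ : 0 < δ)
    (hg : HarmonicOnNhd g (Metric.ball c δ)) :
    ENNReal.ofReal (Real.pi * δ ^ 2) * ‖g c‖ₑ ≤ ∫⁻ z in Metric.ball c δ, ‖g z‖ₑ := by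
  set G : ℂ → ℂ := (Metric.ball 0 δ).indicator (fun z => g (c + z)) with hG
  have hGm : Measurable G := by
    classical
    rw [hG, ← Set.piecewise_eq_indicator]
    refine ContinuousOn.measurable_piecewise ?_ continuousOn_const Metric.isOpen_ball.measurableSet
    refine hg.continuousOn.comp (f := fun z => c + z) (by fun_prop) ?_
    intro z hz
    simpa [dist_eq_norm] using hz
  have h1 : ∫⁻ z in Metric.ball c δ, ‖g z‖ₑ = ∫⁻ z, ‖G z‖ₑ := by
    rw [← lintegral_indicator Metric.isOpen_ball.measurableSet,
      ← lintegral_add_left_eq_self _ c]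
    congr 1
    ext z
    by_cases hz : z ∈ Metric.ball 0 δ
    · have : c + z ∈ Metric.ball c δ := by simpa [dist_eq_norm] using hz
      simp [hG, hz, this]
    · have : c + z ∉ Metric.ball c δ := by simpa [dist_eq_norm] using hz
      simp [hG, hz, this]
  rw [h1, ← Complex.lintegral_comp_polarCoord_symm]
  have hpm : Measurable fun p : ℝ × ℝ => Complex.polarCoord.symm p := by
    simp only [Complex.polarCoord_symm_apply]
    fun_prop
  have hm : Measurable fun p : ℝ × ℝ =>
      ENNReal.ofReal p.1 • ‖G (Complex.polarCoord.symm p)‖ₑ := by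
    simp only [smul_eq_mul]
    exact (ENNReal.measurable_ofReal.comp measurable_fst).mul (hGm.comp hpm).enorm
  rw [polarCoord_target, Measure.volume_eq_prod, ← Measure.prod_restrict,
    lintegral_prod _ hm.aemeasurable]
  have h2 : ∫⁻ r in Set.Ioc (0 : ℝ) δ, ENNReal.ofReal r = ENNReal.ofReal (δ ^ 2 / 2) := by
    rw [← ofReal_integral_eq_lintegral_ofReal]
    · rw [← intervalIntegral.integral_of_le hδ.le, integral_id]
      simp
    · exact continuous_id.integrableOn_Ioc
    · filter_upwards [ae_restrict_mem measurableSet_Ioc] with r hr using hr.1.le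
  calc ENNReal.ofReal (Real.pi * δ ^ 2) * ‖g c‖ₑ
      = ∫⁻ r in Set.Ioc (0 : ℝ) δ,
          ENNReal.ofReal r * (ENNReal.ofReal (2 * Real.pi) * ‖g c‖ₑ) := by
        rw [lintegral_mul_const _ ENNReal.measurable_ofReal, h2, ← mul_assoc,
          ← ENNReal.ofReal_mul (by positivity)]
        congr 2
        ring
    _ = ∫⁻ r in Set.Ioo (0 : ℝ) δ,
          ENNReal.ofReal r * (ENNReal.ofReal (2 * Real.pi) * ‖g c‖ₑ) := by
        rw [restrict_Ioo_eq_restrict_Ioc]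
    _ ≤ ∫⁻ r in Set.Ioo (0 : ℝ) δ, ∫⁻ θ in Set.Ioo (-Real.pi) Real.pi,
          ENNReal.ofReal r • ‖G (Complex.polarCoord.symm (r, θ))‖ₑ := by
        refine setLIntegral_mono' measurableSet_Ioo fun r hr => ?_
        simp only [smul_eq_mul]
        rw [lintegral_const_mul' _ _ ENNReal.ofReal_ne_top]
        gcongr
        refine (enorm_le_lintegral_circle hr.1
          (hg.mono (Metric.closedBall_subset_ball hr.2))).trans_eq ?_
        congr 1
        ext θ
        have : Complex.polarCoord.symm (r, θ) ∈ Metric.ball (0 : ℂ) δ := by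
          rw [mem_ball_zero_iff, Complex.norm_polarCoord_symm, abs_of_pos hr.1]
          exact hr.2
        rw [hG, Set.indicator_of_mem this]
    _ ≤ _ := lintegral_mono_set Set.Ioo_subset_Ioi_self


noncomputable section

/-- Normalised Lebesgue area measure `dA` on the open unit disc. -/
def area : Measure ℂ := (ENNReal.ofReal Real.pi)⁻¹ • volume.restrict (Metric.ball 0 1)

/-- The standard weight `ω_α(z) = (1 + α) (1 - |z|²)^α`. -/
def weight (α : ℝ) (z : ℂ) : ℝ := (1 + α) * (1 - ‖z‖ ^ 2) ^ α

/-- The measure `ω_α dA` on the open unit disc. -/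
def weightedArea (α : ℝ) : Measure ℂ :=
  area.withDensity fun z => ENNReal.ofReal (weight α z)

/-- The weighted harmonic Bergman space `L²_h(ω_α)`: the (classes of) functions in `L²(ω_α)` that
are harmonic on the open unit disc. -/
def harmonicBergman (α : ℝ) : Submodule ℂ (Lp ℂ 2 (weightedArea α)) where
  carrier := {f | ∃ g : ℂ → ℂ, HarmonicOnNhd g (Metric.ball 0 1) ∧ f =ᵐ[weightedArea α] g}
  zero_mem' := ⟨0, harmonicOnNhd_const 0, Lp.coeFn_zero ℂ 2 _⟩
  add_mem' := by
    rintro f₁ f₂ ⟨g₁, hg₁, h₁⟩ ⟨g₂, hg₂, h₂⟩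
    exact ⟨g₁ + g₂, hg₁.add hg₂, (Lp.coeFn_add f₁ f₂).trans (h₁.add h₂)⟩
  smul_mem' := by
    rintro c f ⟨g, hg, h⟩
    exact ⟨c • g, hg.comp_CLM (ContinuousLinearMap.mul ℝ ℂ c),
      (Lp.coeFn_smul c f).trans (h.const_smul c)⟩

theorem ae_mem_ball (α : ℝ) : ∀ᵐ z ∂(weightedArea α), z ∈ Metric.ball (0 : ℂ) 1 := by
  refine (withDensity_absolutelyContinuous _ _).ae_le ?_
  exact Measure.ae_smul_measure (ae_restrict_mem Metric.isOpen_ball.measurableSet) _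

theorem weight_continuousOn (α : ℝ) : ContinuousOn (weight α) (Metric.ball 0 1) := by
  unfold weight
  refine continuousOn_const.mul (ContinuousOn.rpow_const (by fun_prop) ?_)
  intro z hz
  left
  have := mem_ball_zero_iff.1 hz
  nlinarith [norm_nonneg z]

theorem weight_pos {α : ℝ} (hα : -1 < α) {z : ℂ} (hz : z ∈ Metric.ball (0 : ℂ) 1) :
    0 < weight α z := by
  have := mem_ball_zero_iff.1 hz
  refine mul_pos (by linarith) (Real.rpow_pos_of_pos ?_ _)
  nlinarith [norm_nonneg z]

theorem volume_restrict_le {α : ℝ} (hα : -1 < α) {ρ : ℝ} (hρ : ρ < 1) :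
    ∃ K : ℝ≥0∞, K ≠ ∞ ∧ volume.restrict (Metric.ball (0 : ℂ) ρ) ≤ K • weightedArea α := by
  have hsub : Metric.closedBall (0 : ℂ) ρ ⊆ Metric.ball 0 1 := Metric.closedBall_subset_ball hρ
  obtain ⟨m, hm, hle⟩ : ∃ m : ℝ, 0 < m ∧ ∀ z ∈ Metric.closedBall (0 : ℂ) ρ, m ≤ weight α z := by
    rcases (Metric.closedBall (0 : ℂ) ρ).eq_empty_or_nonempty with h | h
    · exact ⟨1, one_pos, by simp [h]⟩
    · obtain ⟨x, hx, hmin⟩ := (isCompact_closedBall (0 : ℂ) ρ).exists_isMinOn h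
        ((weight_continuousOn α).mono hsub)
      exact ⟨weight α x, weight_pos hα (hsub hx), fun z hz => hmin hz⟩
  have hm0 : ENNReal.ofReal m ≠ 0 := by simpa using hm
  have hpi0 : ENNReal.ofReal Real.pi ≠ 0 := by simpa using Real.pi_pos
  refine ⟨ENNReal.ofReal Real.pi * (ENNReal.ofReal m)⁻¹,
    ENNReal.mul_ne_top ENNReal.ofReal_ne_top (ENNReal.inv_ne_top.2 hm0), ?_⟩
  refine Measure.le_iff.2 fun s hs => ?_
  rw [Measure.restrict_apply hs, Measure.smul_apply, weightedArea, withDensity_apply _ hs,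
    smul_eq_mul]
  set t := s ∩ Metric.ball (0 : ℂ) ρ
  have ht : MeasurableSet t := hs.inter Metric.isOpen_ball.measurableSet
  have h1 : area t = (ENNReal.ofReal Real.pi)⁻¹ * volume t := by
    rw [area, Measure.smul_apply, smul_eq_mul, Measure.restrict_apply ht,
      Set.inter_eq_left.2 (Set.inter_subset_right.trans
        (Metric.ball_subset_closedBall.trans hsub))]
  have h2 : ENNReal.ofReal m * area t ≤ ∫⁻ z in s, ENNReal.ofReal (weight α z) ∂area :=
    calc ENNReal.ofReal m * area t = ∫⁻ _ in t, ENNReal.ofReal m ∂area := by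
          rw [setLIntegral_const]
      _ ≤ ∫⁻ z in t, ENNReal.ofReal (weight α z) ∂area :=
          setLIntegral_mono' ht fun z hz =>
            ENNReal.ofReal_le_ofReal (hle z (Metric.ball_subset_closedBall hz.2))
      _ ≤ _ := lintegral_mono_set Set.inter_subset_left
  calc volume t = ENNReal.ofReal Real.pi * (ENNReal.ofReal m)⁻¹ * (ENNReal.ofReal m * area t) := by
        rw [h1, mul_assoc, ← mul_assoc (ENNReal.ofReal m)⁻¹,
          ENNReal.inv_mul_cancel hm0 ENNReal.ofReal_ne_top, one_mul, ← mul_assoc,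
          ENNReal.mul_inv_cancel hpi0 ENNReal.ofReal_ne_top, one_mul]
    _ ≤ _ := by gcongr

/-- Point evaluations are bounded on `L²_h(ω_α)`, uniformly on smaller discs. -/
theorem exists_norm_le {α : ℝ} (hα : -1 < α) {R : ℝ} (hR : R < 1) :
    ∃ C : ℝ, ∀ (f : Lp ℂ 2 (weightedArea α)) (g : ℂ → ℂ), HarmonicOnNhd g (Metric.ball 0 1) →
      f =ᵐ[weightedArea α] g → ∀ c ∈ Metric.closedBall (0 : ℂ) R, ‖g c‖ ≤ C * ‖f‖ := by
  obtain ⟨K, hK, hle⟩ := volume_restrict_le hα (ρ := (1 + R) / 2) (by linarith)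
  set ν := volume.restrict (Metric.ball (0 : ℂ) ((1 + R) / 2)) with hν
  set δ := (1 - R) / 2 with hδ
  have hδ0 : 0 < δ := by rw [hδ]; linarith
  set a := ENNReal.ofReal (Real.pi * δ ^ 2)
  have ha0 : a ≠ 0 := by simpa [a] using mul_pos Real.pi_pos (pow_pos hδ0 2)
  have hνfin : ν Set.univ ≠ ∞ := by
    rw [hν, Measure.restrict_apply_univ]
    exact measure_ball_lt_top.ne
  set B : ℝ≥0∞ := a⁻¹ * (K ^ (1 / (2 : ℝ≥0∞)).toReal *
    ν Set.univ ^ (1 / (1 : ℝ≥0∞).toReal - 1 / (2 : ℝ≥0∞).toReal)) with hB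
  have hBtop : B ≠ ∞ := by
    refine ENNReal.mul_ne_top (ENNReal.inv_ne_top.2 ha0) (ENNReal.mul_ne_top ?_ ?_)
    · exact ENNReal.rpow_ne_top_of_nonneg (by positivity) hK
    · exact ENNReal.rpow_ne_top_of_nonneg (by norm_num) hνfin
  refine ⟨B.toReal, fun f g hg hfg c hc => ?_⟩
  have hc' : ‖c‖ ≤ R := by simpa using hc
  have hsub : Metric.ball c δ ⊆ Metric.ball 0 ((1 + R) / 2) := by
    apply Metric.ball_subset_ball'
    rw [dist_zero_right, hδ]
    linarith
  have hsub1 : Metric.ball (0 : ℂ) ((1 + R) / 2) ⊆ Metric.ball 0 1 :=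
    Metric.ball_subset_ball (by linarith)
  have hgm : AEStronglyMeasurable g ν :=
    (hg.continuousOn.mono hsub1).aestronglyMeasurable Metric.isOpen_ball.measurableSet
  have h1 : a * ‖g c‖ₑ ≤ eLpNorm g 1 ν := by
    rw [eLpNorm_one_eq_lintegral_enorm]
    exact (enorm_le_lintegral_ball hδ0 (hg.mono (hsub.trans hsub1))).trans
      (lintegral_mono_set hsub)
  have h2 : eLpNorm g 2 ν ≤ K ^ (1 / (2 : ℝ≥0∞)).toReal * ‖f‖ₑ := by
    refine (eLpNorm_mono_measure g hle).trans ?_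
    rw [eLpNorm_smul_measure_of_ne_top (by norm_num), ← eLpNorm_congr_ae hfg, smul_eq_mul,
      ← Lp.enorm_def]
  have h5 : a * ‖g c‖ₑ ≤ K ^ (1 / (2 : ℝ≥0∞)).toReal * ‖f‖ₑ *
      ν Set.univ ^ (1 / (1 : ℝ≥0∞).toReal - 1 / (2 : ℝ≥0∞).toReal) :=
    h1.trans ((eLpNorm_le_eLpNorm_mul_rpow_measure_univ (p := 1) (q := 2) (by norm_num) hgm).trans
      (mul_le_mul' h2 le_rfl))
  have h3 : ‖g c‖ₑ ≤ B * ‖f‖ₑ :=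
    calc ‖g c‖ₑ = a⁻¹ * (a * ‖g c‖ₑ) := by
          rw [← mul_assoc, ENNReal.inv_mul_cancel ha0 ENNReal.ofReal_ne_top, one_mul]
      _ ≤ a⁻¹ * (K ^ (1 / (2 : ℝ≥0∞)).toReal * ‖f‖ₑ *
          ν Set.univ ^ (1 / (1 : ℝ≥0∞).toReal - 1 / (2 : ℝ≥0∞).toReal)) :=
          mul_le_mul' le_rfl h5
      _ = B * ‖f‖ₑ := by rw [hB]; ring
  have h4 := ENNReal.toReal_mono (ENNReal.mul_ne_top hBtop enorm_ne_top) h3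
  simpa [ENNReal.toReal_mul] using h4

theorem isClosed_harmonicBergman (α : ℝ) :
    IsClosed (harmonicBergman α : Set (Lp ℂ 2 (weightedArea α))) := by
  rcases le_or_gt α (-1) with hα | hα
  · have h0 : weightedArea α = 0 := by
      rw [weightedArea, withDensity_eq_zero_iff (by
        unfold weight
        fun_prop)]
      have h : ∀ᵐ z ∂area, z ∈ Metric.ball (0 : ℂ) 1 :=
        Measure.ae_smul_measure (ae_restrict_mem Metric.isOpen_ball.measurableSet) _
      filter_upwards [h] with z hz
      have hz' := mem_ball_zero_iff.1 hz
      refine ENNReal.ofReal_of_nonpos (mul_nonpos_of_nonpos_of_nonneg (by linarith)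
        (Real.rpow_nonneg ?_ _))
      nlinarith [norm_nonneg z]
    have huniv : (harmonicBergman α : Set (Lp ℂ 2 (weightedArea α))) = Set.univ := by
      refine Set.eq_univ_of_forall fun f => ⟨0, harmonicOnNhd_const 0, ?_⟩
      have hF : ∀ᵐ _z ∂(weightedArea α), False := by
        rw [h0]
        simp
      filter_upwards [hF] with z hz using hz.elim
    rw [huniv]
    exact isClosed_univ
  refine IsSeqClosed.isClosed fun f f₀ hf hlim => ?_
  choose g hg hfg using hf
  have hcauchy : ∀ R < 1, UniformCauchySeqOn g atTop (Metric.closedBall 0 R) := by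
    intro R hR
    obtain ⟨C, hC⟩ := exists_norm_le hα hR
    rw [Metric.uniformCauchySeqOn_iff]
    intro ε hε
    obtain ⟨N, hN⟩ := Metric.cauchySeq_iff.1 hlim.cauchySeq (ε / (|C| + 1)) (by positivity)
    refine ⟨N, fun m hm n hn x hx => ?_⟩
    have h1 := hN m hm n hn
    have h2 := hC (f m - f n) (g m - g n) ((hg m).sub (hg n))
      ((Lp.coeFn_sub _ _).trans ((hfg m).sub (hfg n))) x hx
    rw [dist_eq_norm] at h1 ⊢
    calc ‖g m x - g n x‖ ≤ C * ‖f m - f n‖ := h2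
      _ ≤ (|C| + 1) * ‖f m - f n‖ := by
          gcongr; linarith [le_abs_self C]
      _ < (|C| + 1) * (ε / (|C| + 1)) := by gcongr
      _ = ε := by field_simp
  have hpt : ∀ z : ℂ, ∃ y, z ∈ Metric.ball (0 : ℂ) 1 → Tendsto (fun n => g n z) atTop (𝓝 y) := by
    intro z
    by_cases hz : z ∈ Metric.ball (0 : ℂ) 1
    · obtain ⟨y, hy⟩ := cauchySeq_tendsto_of_complete
        ((hcauchy ‖z‖ (mem_ball_zero_iff.1 hz)).cauchySeq (x := z) (by simp))
      exact ⟨y, fun _ => hy⟩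
    · exact ⟨0, fun h => absurd h hz⟩
  choose g₀ hg₀ using hpt
  refine ⟨g₀, ?_, ?_⟩
  · intro z hz
    have hz' := mem_ball_zero_iff.1 hz
    have hR : (1 + ‖z‖) / 2 < 1 := by linarith
    refine harmonic_of_uniform_limit (R := (1 + ‖z‖) / 2) (by positivity)
      (fun n => (hg n).mono (Metric.closedBall_subset_ball hR))
      ((hcauchy _ hR).tendstoUniformlyOn_of_tendsto fun x hx =>
        hg₀ x (Metric.closedBall_subset_ball hR hx)) z ?_
    rw [mem_ball_zero_iff]
    linarith
  · obtain ⟨ns, hns, hae⟩ := (tendstoInMeasure_of_tendsto_Lp hlim).exists_seq_tendsto_ae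
    filter_upwards [hae, ae_mem_ball α, ae_all_iff.2 hfg] with z h1 h2 h3
    refine tendsto_nhds_unique h1 ?_
    simp only [h3]
    exact (hg₀ z h2).comp hns.tendsto_atTop

instance instCompleteSpaceHarmonicBergman (α : ℝ) : CompleteSpace (harmonicBergman α) :=
  (isClosed_harmonicBergman α).completeSpace_coe

/-- Multiplication by a function `φ ∈ L^∞(ω_α)`, as a bounded operator on `L²(ω_α)`. -/
def mulOperator (α : ℝ) (φ : ℂ → ℂ) (hφ : MemLp φ ∞ (weightedArea α)) :
    Lp ℂ 2 (weightedArea α) →L[ℂ] Lp ℂ 2 (weightedArea α) :=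
  (ContinuousLinearMap.mul ℂ ℂ).holderL (weightedArea α) ∞ 2 2 (hφ.toLp φ)

/-- The Toeplitz operator `T_φ f = P (φ f)` on `L²_h(ω_α)`, where `P` is the orthogonal projection
of `L²(ω_α)` onto `L²_h(ω_α)`. -/
def toeplitz (α : ℝ) (φ : ℂ → ℂ) (hφ : MemLp φ ∞ (weightedArea α)) :
    harmonicBergman α →L[ℂ] harmonicBergman α :=
  (harmonicBergman α).orthogonalProjectionOnto ∘L mulOperator α φ hφ ∘L (harmonicBergman α).subtypeL

/-- The kernel `K^α_z(w) = (1 - z̄ w)^{-(2+α)}` of the analytic weighted Bergman space. -/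
def bergmanKernel (α : ℝ) (z w : ℂ) : ℂ := 1 / (1 - conj z * w) ^ ((2 + α : ℝ) : ℂ)

/-- The reproducing kernel `R^α_z = K^α_z + conj K^α_z - 1` of `L²_h(ω_α)`. -/
def harmonicKernel (α : ℝ) (z w : ℂ) : ℂ :=
  bergmanKernel α z w + conj (bergmanKernel α z w) - 1

/-- The squared norm `‖R^α_z‖²` in `L²(ω_α)`. -/
def harmonicKernelNormSq (α : ℝ) (z : ℂ) : ℝ :=
  ∫ w, ‖harmonicKernel α z w‖ ^ 2 ∂(weightedArea α)

/-- The Berezin transform of `φ`. -/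
def berezin (α : ℝ) (φ : ℂ → ℝ) (z : ℂ) : ℝ :=
  1 / harmonicKernelNormSq α z * ∫ w, φ w * ‖harmonicKernel α z w‖ ^ 2 ∂(weightedArea α)

/-- `ψ` belongs to `L^∞(ω_α)` and is invertible in the algebra `L^∞(ω_α)`. -/
def IsInvertibleLInfty (α : ℝ) (ψ : ℂ → ℝ) : Prop :=
  MemLp ψ ∞ (weightedArea α) ∧
    ∃ η : ℂ → ℝ, MemLp η ∞ (weightedArea α) ∧ ∀ᵐ z ∂(weightedArea α), ψ z * η z = 1

/-- `χ_G dA` is a reverse Carleson measure for `L²_h(ω_α)`. -/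
def IsReverseCarleson (α : ℝ) (G : Set ℂ) : Prop :=
  ∃ C : ℝ, 0 < C ∧ ∀ f : Lp ℂ 2 (weightedArea α), f ∈ harmonicBergman α →
    ∫ z, ‖f z‖ ^ 2 ∂(weightedArea α) ≤ C * ∫ z in G, ‖f z‖ ^ 2 ∂(weightedArea α)

end

end HarmonicBergman

open HarmonicBergman

/-!
The quadratic form of `T_φ` is `∫ |f|² φ ω_α dA`. Since `‖T_φ f‖² ≤ ‖φ‖_∞ ⟨T_φ f, f⟩`, the operator
is invertible exactly when this form is bounded below by a multiple of `‖f‖²`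
(`isUnit_toeplitz_iff`). Testing the bound on the kernels `R_z` bounds the Berezin transform from
below (`le_berezin`), and the bound follows at once from the reverse Carleson property. The
substance is that a lower bound for the Berezin transform implies the reverse Carleson property.

The automorphism `moebius z`, `w ↦ (z - w) / (1 - z̄ w)`, carries `ω_α dA` to `|k_z|² ω_α dA`, where
`|k_z|²` (`kernelDensity`) is the squared modulus of the normalised analytic kernel
(`lintegral_comp_moebius`). As `|R_z|² / ‖R_z‖²` is at most a constant times `|k_z|²`, a lower bound
for the Berezin transform forces some `G = {φ > r}` to satisfy `μ (moebius z ⁻¹' G) ≥ δ > 0` for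
almost every `z`, where `μ = ω_α dA` (`exists_le_measure_preimage_moebius`).

A set `G` with this property is reverse Carleson (`exists_lintegral_le_setLIntegral`). Since `μ` is
a finite measure, a disc `B(0, ρ)` with `ρ < 1` carries all but a small part of it. Call `z` bad if
`|f z|²` is small compared to the integral of `|f ∘ moebius z|²` over a larger disc `B(0, R)`;
averaging over pseudohyperbolic discs is bounded on `L¹(μ)`
(`lintegral_lintegral_comp_moebius_le`), so bad points contribute little to `∫ |f|²`. At
the remaining points the harmonic function `h = f ∘ moebius z / f z` has `h 0 = 1` and a bounded
mean square on `B(0, R)`. Such functions form a normal family, and the zero set of a harmonic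
function that is nonzero at the centre is null, so `|h| ≥ η` on `B(0, ρ)` off a set of small
measure, with `η` independent of `f` and `z` (`exists_measure_sublevel_le`). Hence `|f z|²` is at
most a constant times the integral of `|f ∘ moebius z|²` over the part of `moebius z ⁻¹' G` in
`B(0, ρ)`, and integrating in `z` with the same averaging estimate bounds `∫ |f|²` by a constant
times `∫_G |f|²`.

The formula for `‖R_z‖²` comes from expanding `R_z = K_z + conj K_z - 1`: powers of `K_z` integrate
to their value at `0`, and `∫ |K_z|²` is evaluated by the change of variables.
-/

namespace HarmonicBergman

/-! ### Disc automorphisms -/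

/-- The involutive automorphism of the unit disc that exchanges `0` and `z`. -/
noncomputable def moebius (z w : ℂ) : ℂ := (z - w) / (1 - conj z * w)

theorem one_sub_norm_sq_pos {z : ℂ} (hz : z ∈ Metric.ball (0 : ℂ) 1) : 0 < 1 - ‖z‖ ^ 2 := by
  have := mem_ball_zero_iff.1 hz
  nlinarith [norm_nonneg z]

theorem one_sub_norm_le_norm_one_sub {z w : ℂ} (hz : z ∈ Metric.ball (0 : ℂ) 1) :
    1 - ‖w‖ ≤ ‖1 - conj z * w‖ := by
  have h1 := mem_ball_zero_iff.1 hz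
  have h2 := norm_sub_norm_le 1 (conj z * w)
  rw [norm_one, norm_mul, RCLike.norm_conj] at h2
  nlinarith [norm_nonneg w]

theorem norm_one_sub_pos {z w : ℂ} (hz : z ∈ Metric.ball (0 : ℂ) 1)
    (hw : w ∈ Metric.ball (0 : ℂ) 1) : 0 < ‖1 - conj z * w‖ :=
  (sub_pos.2 (mem_ball_zero_iff.1 hw)).trans_le (one_sub_norm_le_norm_one_sub hz)

theorem one_sub_ne_zero {z w : ℂ} (hz : z ∈ Metric.ball (0 : ℂ) 1)
    (hw : w ∈ Metric.ball (0 : ℂ) 1) : 1 - conj z * w ≠ 0 :=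
  norm_pos_iff.1 (norm_one_sub_pos hz hw)

theorem norm_one_sub_comm (z w : ℂ) : ‖1 - conj z * w‖ = ‖1 - conj w * z‖ := by
  rw [← RCLike.norm_conj (1 - conj z * w)]
  simp [mul_comm]

theorem norm_moebius_comm (z w : ℂ) : ‖moebius z w‖ = ‖moebius w z‖ := by
  rw [moebius, moebius, norm_div, norm_div, norm_one_sub_comm, norm_sub_rev]

theorem moebius_zero (z : ℂ) : moebius z 0 = z := by simp [moebius]

theorem one_sub_norm_moebius_sq {z w : ℂ} (hz : z ∈ Metric.ball (0 : ℂ) 1)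
    (hw : w ∈ Metric.ball (0 : ℂ) 1) :
    1 - ‖moebius z w‖ ^ 2 = (1 - ‖z‖ ^ 2) * (1 - ‖w‖ ^ 2) / ‖1 - conj z * w‖ ^ 2 := by
  have h := norm_one_sub_pos hz hw
  rw [moebius, norm_div, div_pow, eq_div_iff (by positivity), sub_mul,
    div_mul_cancel₀ _ (by positivity)]
  simp only [← Complex.normSq_eq_norm_sq, Complex.normSq_apply]
  simp
  ring

theorem moebius_mem_ball {z w : ℂ} (hz : z ∈ Metric.ball (0 : ℂ) 1)
    (hw : w ∈ Metric.ball (0 : ℂ) 1) : moebius z w ∈ Metric.ball (0 : ℂ) 1 := by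
  have h1 := one_sub_norm_moebius_sq hz hw
  have h2 : 0 < (1 - ‖z‖ ^ 2) * (1 - ‖w‖ ^ 2) / ‖1 - conj z * w‖ ^ 2 :=
    div_pos (mul_pos (one_sub_norm_sq_pos hz) (one_sub_norm_sq_pos hw))
      (pow_pos (norm_one_sub_pos hz hw) 2)
  rw [mem_ball_zero_iff]
  nlinarith [norm_nonneg (moebius z w)]

theorem one_sub_mul_moebius {z w : ℂ} (hz : z ∈ Metric.ball (0 : ℂ) 1)
    (hw : w ∈ Metric.ball (0 : ℂ) 1) :
    1 - conj z * moebius z w = ((1 - ‖z‖ ^ 2 : ℝ) : ℂ) / (1 - conj z * w) := by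
  have h := one_sub_ne_zero hz hw
  rw [moebius, eq_div_iff h, sub_mul, mul_assoc, div_mul_cancel₀ _ h]
  have h2 : conj z * z = ((‖z‖ ^ 2 : ℝ) : ℂ) := by
    rw [mul_comm, Complex.mul_conj, Complex.normSq_eq_norm_sq]
  push_cast at h2 ⊢
  linear_combination -h2

theorem moebius_moebius {z w : ℂ} (hz : z ∈ Metric.ball (0 : ℂ) 1)
    (hw : w ∈ Metric.ball (0 : ℂ) 1) : moebius z (moebius z w) = w := by
  have h := one_sub_ne_zero hz hw
  have h0 : ((1 - ‖z‖ ^ 2 : ℝ) : ℂ) ≠ 0 := by exact_mod_cast (one_sub_norm_sq_pos hz).ne'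
  have h2 : conj z * z = ((‖z‖ ^ 2 : ℝ) : ℂ) := by
    rw [mul_comm, Complex.mul_conj, Complex.normSq_eq_norm_sq]
  conv_lhs => rw [moebius, one_sub_mul_moebius hz hw]
  rw [div_eq_iff (div_ne_zero h0 h), moebius, mul_div_assoc', eq_div_iff h, sub_mul,
    div_mul_cancel₀ _ h]
  push_cast at h2 ⊢
  linear_combination -w * h2

theorem hasDerivAt_moebius {z w : ℂ} (hz : z ∈ Metric.ball (0 : ℂ) 1)
    (hw : w ∈ Metric.ball (0 : ℂ) 1) :
    HasDerivAt (moebius z) (-((1 - ‖z‖ ^ 2 : ℝ) : ℂ) / (1 - conj z * w) ^ 2) w := by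
  have h2 : conj z * z = ((‖z‖ ^ 2 : ℝ) : ℂ) := by
    rw [mul_comm, Complex.mul_conj, Complex.normSq_eq_norm_sq]
  have h := ((hasDerivAt_id w).const_sub z).div
    (((hasDerivAt_id w).const_mul (conj z)).const_sub 1) (one_sub_ne_zero hz hw)
  refine h.congr_deriv ?_
  congr 1
  push_cast at h2 ⊢
  simp only [id]
  linear_combination h2

theorem image_moebius_ball {z : ℂ} (hz : z ∈ Metric.ball (0 : ℂ) 1) :
    moebius z '' Metric.ball 0 1 = Metric.ball 0 1 := by
  ext w
  constructor
  · rintro ⟨u, hu, rfl⟩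
    exact moebius_mem_ball hz hu
  · exact fun hw => ⟨moebius z w, moebius_mem_ball hz hw, moebius_moebius hz hw⟩

theorem measurable_moebius_uncurry : Measurable fun p : ℂ × ℂ => moebius p.1 p.2 := by
  have : Measurable fun p : ℂ × ℂ => conj p.1 :=
    (Complex.continuous_conj.comp continuous_fst).measurable
  unfold moebius
  fun_prop

theorem measurable_moebius (z : ℂ) : Measurable (moebius z) :=
  measurable_moebius_uncurry.comp measurable_prodMk_left

/-! ### The weighted area measure and its behaviour under disc automorphisms -/

theorem measurable_weight (α : ℝ) : Measurable (weight α) := by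
  unfold weight
  fun_prop

theorem lintegral_weightedArea (α : ℝ) (g : ℂ → ℝ≥0∞) :
    ∫⁻ w, g w ∂(weightedArea α) =
      (ENNReal.ofReal Real.pi)⁻¹ *
        ∫⁻ w in Metric.ball 0 1, ENNReal.ofReal (weight α w) * g w := by
  rw [weightedArea, lintegral_withDensity_eq_lintegral_mul_non_measurable _
    (measurable_weight α).ennreal_ofReal (Eventually.of_forall fun _ => ENNReal.ofReal_lt_top),
    area, lintegral_smul_measure]
  rfl

/-- The Radon-Nikodym density `|k_z|² = ((1 - |z|²) / |1 - z̄ w|²)^(2+α)` of the image of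
`ω_α dA` under `moebius z`; it is the squared modulus of the normalised Bergman kernel. -/
noncomputable def kernelDensity (α : ℝ) (z w : ℂ) : ℝ :=
  ((1 - ‖z‖ ^ 2) / ‖1 - conj z * w‖ ^ 2) ^ (2 + α)

theorem kernelDensity_nonneg (α : ℝ) {z : ℂ} (hz : z ∈ Metric.ball (0 : ℂ) 1) (w : ℂ) :
    0 ≤ kernelDensity α z w :=
  Real.rpow_nonneg (div_nonneg (one_sub_norm_sq_pos hz).le (by positivity)) _

theorem measurable_kernelDensity_uncurry (α : ℝ) :
    Measurable fun p : ℂ × ℂ => kernelDensity α p.1 p.2 := by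
  have : Measurable fun p : ℂ × ℂ => conj p.1 :=
    (Complex.continuous_conj.comp continuous_fst).measurable
  unfold kernelDensity
  fun_prop

theorem measurable_kernelDensity (α : ℝ) (z : ℂ) : Measurable (kernelDensity α z) := by
  unfold kernelDensity
  fun_prop

theorem abs_det_mul (c : ℂ) :
    |((ContinuousLinearMap.toSpanSingleton ℂ c).restrictScalars ℝ).det| = ‖c‖ ^ 2 := by
  have h0 : (((ContinuousLinearMap.toSpanSingleton ℂ c).restrictScalars ℝ : ℂ →L[ℝ] ℂ) :
      ℂ →ₗ[ℝ] ℂ) = (c • (LinearMap.id : ℂ →ₗ[ℂ] ℂ)).restrictScalars ℝ := by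
    ext; simp [mul_comm]
  have h : ((ContinuousLinearMap.toSpanSingleton ℂ c).restrictScalars ℝ).det = ‖c‖ ^ 2 := by
    have h1 : LinearMap.det (c • (LinearMap.id : ℂ →ₗ[ℂ] ℂ)) = c := by
      rw [LinearMap.det_smul, LinearMap.det_id, Module.finrank_self, pow_one, mul_one]
    have h2 := LinearMap.det_restrictScalars (R := ℝ) (f := c • (LinearMap.id : ℂ →ₗ[ℂ] ℂ))
    rw [h1, Algebra.norm_complex_apply, Complex.normSq_eq_norm_sq, ← h0] at h2
    exact h2
  rw [h, abs_of_nonneg (by positivity)]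

/-- The Jacobian of `moebius z` times the transported weight is `ω_α |k_z|²`. -/
theorem weight_moebius (α : ℝ) {z w : ℂ} (hz : z ∈ Metric.ball (0 : ℂ) 1)
    (hw : w ∈ Metric.ball (0 : ℂ) 1) :
    ‖-((1 - ‖z‖ ^ 2 : ℝ) : ℂ) / (1 - conj z * w) ^ 2‖ ^ 2 * weight α (moebius z w) =
      weight α w * kernelDensity α z w := by
  have hz1 := one_sub_norm_sq_pos hz
  have hw1 := one_sub_norm_sq_pos hw
  have h := norm_one_sub_pos hz hw
  have hq : 0 < (1 - ‖z‖ ^ 2) / ‖1 - conj z * w‖ ^ 2 := by positivity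
  rw [weight, weight, kernelDensity, one_sub_norm_moebius_sq hz hw, norm_div, norm_neg,
    Complex.norm_real, Real.norm_eq_abs, abs_of_pos hz1, norm_pow, mul_right_comm,
    mul_div_right_comm, Real.mul_rpow hq.le hw1.le, Real.rpow_add hq, Real.rpow_two]
  ring

/-- Change of variables: the image of `ω_α dA` under `moebius z` has density `|k_z|²`. -/
theorem lintegral_comp_moebius {α : ℝ} (hα : -1 < α) {z : ℂ} (hz : z ∈ Metric.ball (0 : ℂ) 1)
    (g : ℂ → ℝ≥0∞) :
    ∫⁻ w, g (moebius z w) ∂(weightedArea α) =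
      ∫⁻ u, ENNReal.ofReal (kernelDensity α z u) * g u ∂(weightedArea α) := by
  rw [lintegral_weightedArea, lintegral_weightedArea]
  congr 1
  have hinj : Set.InjOn (moebius z) (Metric.ball 0 1) := fun u hu v hv h => by
    rw [← moebius_moebius hz hu, h, moebius_moebius hz hv]
  have key := lintegral_image_eq_lintegral_abs_det_fderiv_mul volume
    (Metric.isOpen_ball.measurableSet) (fun w hw =>
      ((hasDerivAt_moebius hz hw).hasFDerivAt.restrictScalars ℝ).hasFDerivWithinAt) hinj
    (fun w => ENNReal.ofReal (weight α w) * g (moebius z w))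
  rw [image_moebius_ball hz] at key
  rw [key]
  refine setLIntegral_congr_fun Metric.isOpen_ball.measurableSet fun w hw => ?_
  rw [moebius_moebius hz hw, abs_det_mul, ← mul_assoc, ← mul_assoc,
    ← ENNReal.ofReal_mul (by positivity), weight_moebius α hz hw,
    ENNReal.ofReal_mul (weight_pos hα hw).le]

theorem integral_weight_radial {α : ℝ} (hα : -1 < α) :
    ∫ r in (0 : ℝ)..1, r * (1 - r ^ 2) ^ α = (2 * (1 + α))⁻¹ := by
  have h1 : 0 < 1 + α := by linarith
  have hc : ContinuousOn (fun r : ℝ => -(2 * (1 + α))⁻¹ * (1 - r ^ 2) ^ (1 + α)) (Set.Icc 0 1) :=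
    continuousOn_const.mul
      (ContinuousOn.rpow_const (by fun_prop) fun _ _ => Or.inr h1.le)
  have hd : ∀ r ∈ Set.Ioo (0 : ℝ) 1,
      HasDerivAt (fun r : ℝ => -(2 * (1 + α))⁻¹ * (1 - r ^ 2) ^ (1 + α))
        (r * (1 - r ^ 2) ^ α) r := by
    intro r hr
    have h2 : (1 - r ^ 2) ≠ 0 := by nlinarith [hr.1, hr.2]
    have h3 := ((((hasDerivAt_id r).pow 2).const_sub 1).rpow_const (p := 1 + α)
      (Or.inl (by simpa using h2))).const_mul (-(2 * (1 + α))⁻¹)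
    refine h3.congr_deriv ?_
    simp only [id, add_sub_cancel_left, Pi.pow_apply]
    field_simp
    norm_num
  have hp : ∀ r ∈ Set.Ioo (0 : ℝ) 1, 0 ≤ r * (1 - r ^ 2) ^ α := fun r hr =>
    mul_nonneg hr.1.le (Real.rpow_nonneg (by nlinarith [hr.1, hr.2]) _)
  rw [intervalIntegral.integral_eq_sub_of_hasDerivAt_of_le zero_le_one hc hd
    (intervalIntegral.intervalIntegrable_deriv_of_nonneg (by rwa [Set.uIcc_of_le zero_le_one])
      (by simpa using hd) (by simpa using hp))]
  simp [Real.zero_rpow h1.ne']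

theorem integral_weight {α : ℝ} (hα : -1 < α) :
    ∫ w in Metric.ball (0 : ℂ) 1, weight α w = Real.pi := by
  have h := integral_fun_norm_addHaar (volume : Measure ℂ)
    (Set.indicator (Set.Iio 1) fun r : ℝ => (1 + α) * (1 - r ^ 2) ^ α)
  have e1 : (fun w : ℂ => Set.indicator (Set.Iio 1)
      (fun r : ℝ => (1 + α) * (1 - r ^ 2) ^ α) ‖w‖) =
      (Metric.ball (0 : ℂ) 1).indicator (weight α) := by
    classical
    ext w
    simp [Set.indicator_apply, weight]
  have e2 : ∀ y : ℝ, y ^ (2 - 1) • (Set.Iio (1 : ℝ)).indicator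
      (fun r : ℝ => (1 + α) * (1 - r ^ 2) ^ α) y =
      (Set.Iio (1 : ℝ)).indicator (fun r => (1 + α) * (r * (1 - r ^ 2) ^ α)) y := by
    intro y
    by_cases hy : y ∈ Set.Iio (1 : ℝ)
    · simp only [Set.indicator_of_mem hy, smul_eq_mul]
      ring
    · simp [Set.indicator_of_notMem hy]
  rw [e1, integral_indicator Metric.isOpen_ball.measurableSet, Complex.finrank_real_complex] at h
  simp only [e2] at h
  rw [h, setIntegral_indicator measurableSet_Iio, Set.Ioi_inter_Iio, ← integral_Ioc_eq_integral_Ioo,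
    integral_const_mul, ← intervalIntegral.integral_of_le zero_le_one, integral_weight_radial hα]
  have h1 : 1 + α ≠ 0 := by linarith
  simp [measureReal_def]
  field_simp

theorem weightedArea_univ {α : ℝ} (hα : -1 < α) : weightedArea α Set.univ = 1 := by
  have hi : Integrable (weight α) (volume.restrict (Metric.ball (0 : ℂ) 1)) :=
    Integrable.of_integral_ne_zero (by rw [integral_weight hα]; exact Real.pi_ne_zero)
  have h0 : 0 ≤ᵐ[volume.restrict (Metric.ball (0 : ℂ) 1)] weight α := by
    filter_upwards [ae_restrict_mem Metric.isOpen_ball.measurableSet] with w hw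
      using (weight_pos hα hw).le
  have h := lintegral_weightedArea α 1
  simp only [Pi.one_apply, lintegral_one, mul_one] at h
  rw [h, ← ofReal_integral_eq_lintegral_ofReal hi h0, integral_weight hα]
  exact ENNReal.inv_mul_cancel (by simpa using Real.pi_pos) ENNReal.ofReal_ne_top

theorem isProbabilityMeasure_weightedArea {α : ℝ} (hα : -1 < α) :
    IsProbabilityMeasure (weightedArea α) := ⟨weightedArea_univ hα⟩

theorem measurePreserving_mul {α : ℝ} {c : ℂ} (hc : ‖c‖ = 1) :
    MeasurePreserving (fun w => c * w) (weightedArea α) (weightedArea α) := by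
  have hm : Measurable fun w : ℂ => c * w := by fun_prop
  refine ⟨hm, Measure.ext_of_lintegral _ fun f hf => ?_⟩
  rw [lintegral_map hf hm, lintegral_weightedArea, lintegral_weightedArea]
  congr 1
  classical
  have hR := (rotation ⟨c, by simp [Submonoid.unitSphere, hc]⟩ : ℂ ≃ₗᵢ[ℝ] ℂ).measurePreserving
  rw [← lintegral_indicator Metric.isOpen_ball.measurableSet,
    ← lintegral_indicator Metric.isOpen_ball.measurableSet, ← hR.lintegral_comp
      (f := (Metric.ball 0 1).indicator fun w => ENNReal.ofReal (weight α w) * f w)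
      ((((measurable_weight α).ennreal_ofReal).mul hf).indicator
        Metric.isOpen_ball.measurableSet)]
  congr 1
  ext w
  simp [Set.indicator_apply, weight]
  rfl

/-- A bounded harmonic function has average `g 0` against the rotation invariant
probability measure `ω_α dA`. -/
theorem integral_harmonic {α : ℝ} (hα : -1 < α) {g : ℂ → ℂ} (hm : Measurable g)
    (hg : HarmonicOnNhd g (Metric.ball 0 1)) {M : ℝ}
    (hM : ∀ w ∈ Metric.ball (0 : ℂ) 1, ‖g w‖ ≤ M) :
    ∫ w, g w ∂(weightedArea α) = g 0 := by
  have := isProbabilityMeasure_weightedArea hα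
  -- average over all rotations and exchange the integrals
  set ν : Measure ℝ := volume.restrict (Set.Ioc 0 (2 * Real.pi)) with hν
  have hexp : ∀ θ : ℝ, ‖Complex.exp (θ * Complex.I)‖ = 1 := Complex.norm_exp_ofReal_mul_I
  have hrot : ∀ θ : ℝ, ∫ w, g (Complex.exp (θ * Complex.I) * w) ∂(weightedArea α) =
      ∫ w, g w ∂(weightedArea α) := by
    intro θ
    have hp := measurePreserving_mul (α := α) (hexp θ)
    rw [← hp.map_eq, integral_map hp.measurable.aemeasurable
      (hm.aestronglyMeasurable)]
    rw [hp.map_eq]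
  have hint : Integrable (Function.uncurry fun (θ : ℝ) (w : ℂ) =>
      g (Complex.exp (θ * Complex.I) * w)) (ν.prod (weightedArea α)) := by
    have hmeas : Measurable (Function.uncurry fun (θ : ℝ) (w : ℂ) =>
        g (Complex.exp (θ * Complex.I) * w)) := by
      refine hm.comp ?_
      fun_prop
    refine Integrable.of_bound hmeas.aestronglyMeasurable M ?_
    filter_upwards [Measure.quasiMeasurePreserving_snd.ae (ae_mem_ball α)] with p hp
    refine hM _ ?_
    rw [mem_ball_zero_iff, norm_mul, hexp, one_mul]
    exact mem_ball_zero_iff.1 hp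
  have hswap := integral_integral_swap hint
  have hL : ∫ θ, ∫ w, g (Complex.exp (θ * Complex.I) * w) ∂(weightedArea α) ∂ν =
      (2 * Real.pi) • ∫ w, g w ∂(weightedArea α) := by
    simp only [hrot]
    rw [integral_const, hν, measureReal_restrict_apply_univ, Real.volume_real_Ioc_of_le
      (by positivity), sub_zero]
  have hR : ∫ w, ∫ θ, g (Complex.exp (θ * Complex.I) * w) ∂ν ∂(weightedArea α) =
      (2 * Real.pi) • g 0 := by
    have : ∀ᵐ w ∂(weightedArea α), ∫ θ, g (Complex.exp (θ * Complex.I) * w) ∂ν =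
        (2 * Real.pi) • g 0 := by
      filter_upwards [ae_mem_ball α] with w hw
      have h1 : Real.circleAverage g 0 ‖w‖ = g 0 := by
        refine InnerProductSpace.HarmonicOnNhd.circleAverage_eq (hg.mono ?_)
        rw [abs_of_nonneg (norm_nonneg w)]
        exact Metric.closedBall_subset_ball (mem_ball_zero_iff.1 hw)
      rw [Real.circleAverage_eq_integral_add w.arg] at h1
      rw [← h1, smul_smul, mul_inv_cancel₀ (by positivity), one_smul, hν,
        intervalIntegral.integral_of_le (by positivity)]
      congr 1
      ext θ
      congr 1
      simp only [circleMap, zero_add]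
      push_cast
      rw [add_mul, Complex.exp_add, mul_left_comm, Complex.norm_mul_exp_arg_mul_I]
    rw [integral_congr_ae this, integral_const]
    simp
  rw [hL, hR] at hswap
  exact smul_right_injective ℂ (r := 2 * Real.pi) (by positivity) hswap

theorem lintegral_kernelDensity {α : ℝ} (hα : -1 < α) {z : ℂ} (hz : z ∈ Metric.ball (0 : ℂ) 1) :
    ∫⁻ u, ENNReal.ofReal (kernelDensity α z u) ∂(weightedArea α) = 1 := by
  have h := lintegral_comp_moebius hα hz 1
  simp only [Pi.one_apply, lintegral_one, mul_one, weightedArea_univ hα] at h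
  exact h.symm

theorem integral_kernelDensity {α : ℝ} (hα : -1 < α) {z : ℂ} (hz : z ∈ Metric.ball (0 : ℂ) 1) :
    Integrable (kernelDensity α z) (weightedArea α) ∧
      ∫ u, kernelDensity α z u ∂(weightedArea α) = 1 := by
  have h0 : 0 ≤ᵐ[weightedArea α] kernelDensity α z :=
    Eventually.of_forall fun w => kernelDensity_nonneg α hz w
  have hm : AEStronglyMeasurable (kernelDensity α z) (weightedArea α) :=
    (measurable_kernelDensity α z).aestronglyMeasurable
  constructor
  · rw [← lintegral_ofReal_ne_top_iff_integrable hm h0, lintegral_kernelDensity hα hz]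
    exact ENNReal.one_ne_top
  · rw [integral_eq_lintegral_of_nonneg_ae h0 hm, lintegral_kernelDensity hα hz,
      ENNReal.toReal_one]

/-- Schur-type estimate: averaging over pseudohyperbolic discs of a fixed radius is bounded
on `L¹(ω_α)`. -/
theorem lintegral_lintegral_comp_moebius_le {α : ℝ} (hα : -1 < α) {ρ : ℝ} (hρ : ρ < 1) :
    ∃ C : ℝ≥0∞, C ≠ ∞ ∧ ∀ g : ℂ → ℝ≥0∞, Measurable g →
      ∫⁻ z, ∫⁻ w in Metric.ball 0 ρ, g (moebius z w) ∂(weightedArea α) ∂(weightedArea α) ≤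
        C * ∫⁻ u, g u ∂(weightedArea α) := by
  have := isProbabilityMeasure_weightedArea hα
  have h2α : 0 ≤ 2 + α := by linarith
  set B : Set ℂ := Metric.ball 0 ρ with hB
  have hBm : MeasurableSet B := Metric.isOpen_ball.measurableSet
  set c : ℝ := (1 / (1 - ρ) ^ 2) ^ (2 + α)
  refine ⟨ENNReal.ofReal c, ENNReal.ofReal_ne_top, fun g hg => ?_⟩
  -- the integrand of the double integral after the change of variables `u = moebius z w`
  set Φ : ℂ → ℂ → ℝ≥0∞ := fun z u =>
    ENNReal.ofReal (kernelDensity α z u) * (B.indicator 1 (moebius z u) * g u) with hΦ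
  have hΦm : Measurable (Function.uncurry Φ) :=
    (measurable_kernelDensity_uncurry α).ennreal_ofReal.mul
      (((measurable_one.indicator hBm).comp measurable_moebius_uncurry).mul
        (hg.comp measurable_snd))
  have h1 : ∀ᵐ z ∂(weightedArea α), ∫⁻ w in B, g (moebius z w) ∂(weightedArea α) =
      ∫⁻ u, Φ z u ∂(weightedArea α) := by
    filter_upwards [ae_mem_ball α] with z hz
    rw [← lintegral_indicator hBm, ← lintegral_comp_moebius hα hz]
    refine lintegral_congr_ae ?_
    filter_upwards [ae_mem_ball α] with w hw
    simp only [moebius_moebius hz hw]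
    by_cases h : w ∈ B <;> simp [h]
  rw [lintegral_congr_ae h1, lintegral_lintegral_swap hΦm.aemeasurable,
    ← lintegral_const_mul _ hg]
  refine lintegral_mono_ae ?_
  filter_upwards [ae_mem_ball α] with u hu
  have h2 : ∀ᵐ z ∂(weightedArea α), Φ z u = ENNReal.ofReal (kernelDensity α u z) *
      (B.indicator 1 (moebius u z) *
        ENNReal.ofReal (((1 - ‖z‖ ^ 2) / (1 - ‖u‖ ^ 2)) ^ (2 + α)) * g u) := by
    filter_upwards [ae_mem_ball α] with z hz
    have hz1 := one_sub_norm_sq_pos hz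
    have hu1 := one_sub_norm_sq_pos hu
    have e1 : B.indicator (1 : ℂ → ℝ≥0∞) (moebius z u) = B.indicator 1 (moebius u z) := by
      classical
      simp [Set.indicator_apply, hB, norm_moebius_comm z u]
    have e2 : kernelDensity α z u =
        kernelDensity α u z * ((1 - ‖z‖ ^ 2) / (1 - ‖u‖ ^ 2)) ^ (2 + α) := by
      have hn := norm_one_sub_pos hu hz
      rw [kernelDensity, kernelDensity, ← Real.mul_rpow (by positivity) (by positivity),
        norm_one_sub_comm z u]
      congr 1
      field_simp
    simp only [hΦ]
    rw [e1, e2, ENNReal.ofReal_mul (kernelDensity_nonneg α hu z)]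
    ring
  rw [lintegral_congr_ae h2, ← lintegral_comp_moebius hα hu (fun z => B.indicator 1 (moebius u z) *
        ENNReal.ofReal (((1 - ‖z‖ ^ 2) / (1 - ‖u‖ ^ 2)) ^ (2 + α)) * g u)]
  have h3 : ∀ᵐ w ∂(weightedArea α), B.indicator 1 (moebius u (moebius u w)) *
      ENNReal.ofReal (((1 - ‖moebius u w‖ ^ 2) / (1 - ‖u‖ ^ 2)) ^ (2 + α)) * g u ≤
      ENNReal.ofReal c * g u := by
    filter_upwards [ae_mem_ball α] with w hw
    rw [moebius_moebius hu hw]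
    by_cases h : w ∈ B
    · rw [Set.indicator_of_mem h, Pi.one_apply, one_mul]
      gcongr
      have hw1 := one_sub_norm_sq_pos hw
      have hu1 := one_sub_norm_sq_pos hu
      have hn := norm_one_sub_pos hu hw
      have hwρ := mem_ball_zero_iff.1 h
      have hle := one_sub_norm_le_norm_one_sub (w := w) hu
      rw [one_sub_norm_moebius_sq hu hw]
      refine Real.rpow_le_rpow (by positivity) ?_ h2α
      have e : (1 - ‖u‖ ^ 2) * (1 - ‖w‖ ^ 2) / ‖1 - conj u * w‖ ^ 2 / (1 - ‖u‖ ^ 2) =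
          (1 - ‖w‖ ^ 2) / ‖1 - conj u * w‖ ^ 2 := by field_simp
      rw [e]
      have hρ' : 0 < 1 - ρ := by linarith
      refine div_le_div₀ zero_le_one ?_ (by positivity) ?_
      · nlinarith [sq_nonneg ‖w‖]
      · exact pow_le_pow_left₀ hρ'.le (by linarith) 2
    · simp [h]
  refine (lintegral_mono_ae h3).trans_eq ?_
  simp

/-! ### The reproducing kernel -/

theorem one_sub_mem_slitPlane {z w : ℂ} (hz : z ∈ Metric.ball (0 : ℂ) 1)
    (hw : w ∈ Metric.ball (0 : ℂ) 1) : 1 - conj z * w ∈ Complex.slitPlane := by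
  left
  have h1 := mem_ball_zero_iff.1 hz
  have h2 := mem_ball_zero_iff.1 hw
  have h3 := (Complex.abs_re_le_norm (conj z * w)).trans_eq (norm_mul _ _)
  rw [RCLike.norm_conj] at h3
  have h4 := (abs_le.1 h3).2
  rw [Complex.sub_re, Complex.one_re]
  nlinarith [norm_nonneg z, norm_nonneg w]

theorem bergmanKernel_analyticAt (α : ℝ) {z w : ℂ} (hz : z ∈ Metric.ball (0 : ℂ) 1)
    (hw : w ∈ Metric.ball (0 : ℂ) 1) : AnalyticAt ℂ (bergmanKernel α z) w := by
  unfold bergmanKernel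
  have h1 : AnalyticAt ℂ (fun w => 1 - conj z * w) w := by fun_prop
  refine analyticAt_const.div (h1.cpow analyticAt_const (one_sub_mem_slitPlane hz hw)) ?_
  rw [Complex.cpow_def_of_ne_zero (one_sub_ne_zero hz hw)]
  exact Complex.exp_ne_zero _

theorem measurable_bergmanKernel_uncurry (α : ℝ) :
    Measurable fun p : ℂ × ℂ => bergmanKernel α p.1 p.2 := by
  have : Measurable fun p : ℂ × ℂ => conj p.1 :=
    (Complex.continuous_conj.comp continuous_fst).measurable
  unfold bergmanKernel
  fun_prop

theorem measurable_bergmanKernel (α : ℝ) (z : ℂ) : Measurable (bergmanKernel α z) := by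
  unfold bergmanKernel
  fun_prop

theorem measurable_harmonicKernel_uncurry (α : ℝ) :
    Measurable fun p : ℂ × ℂ => harmonicKernel α p.1 p.2 :=
  ((measurable_bergmanKernel_uncurry α).add
    (Complex.continuous_conj.measurable.comp (measurable_bergmanKernel_uncurry α))).sub_const 1

theorem measurable_harmonicKernel (α : ℝ) (z : ℂ) : Measurable (harmonicKernel α z) :=
  ((measurable_bergmanKernel α z).add
    (Complex.continuous_conj.measurable.comp (measurable_bergmanKernel α z))).sub_const 1

theorem norm_bergmanKernel {α : ℝ} {z w : ℂ} (hz : z ∈ Metric.ball (0 : ℂ) 1)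
    (hw : w ∈ Metric.ball (0 : ℂ) 1) :
    ‖bergmanKernel α z w‖ = (‖1 - conj z * w‖ ^ (2 + α))⁻¹ := by
  rw [bergmanKernel, norm_div, norm_one, one_div]
  congr 1
  rw [Complex.norm_cpow_of_ne_zero (one_sub_ne_zero hz hw)]
  simp

theorem norm_bergmanKernel_sq {α : ℝ} {z w : ℂ} (hz : z ∈ Metric.ball (0 : ℂ) 1)
    (hw : w ∈ Metric.ball (0 : ℂ) 1) :
    ‖bergmanKernel α z w‖ ^ 2 = ((1 - ‖z‖ ^ 2) ^ (2 + α))⁻¹ * kernelDensity α z w := by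
  have h := norm_one_sub_pos hz hw
  have hz1 := one_sub_norm_sq_pos hz
  rw [norm_bergmanKernel hz hw, kernelDensity, Real.div_rpow hz1.le (by positivity),
    ← Real.rpow_natCast_mul h.le, mul_comm ((2 : ℕ) : ℝ), Real.rpow_mul_natCast h.le]
  have : (1 - ‖z‖ ^ 2) ^ (2 + α) ≠ 0 := (Real.rpow_pos_of_pos hz1 _).ne'
  field_simp

theorem norm_bergmanKernel_le {α : ℝ} (hα : -1 < α) {z w : ℂ} (hz : z ∈ Metric.ball (0 : ℂ) 1)
    (hw : w ∈ Metric.ball (0 : ℂ) 1) :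
    ‖bergmanKernel α z w‖ ≤ ((1 - ‖z‖) ^ (2 + α))⁻¹ := by
  have h1 : 0 < 1 - ‖z‖ := sub_pos.2 (mem_ball_zero_iff.1 hz)
  rw [norm_bergmanKernel hz hw, norm_one_sub_comm]
  refine inv_anti₀ (Real.rpow_pos_of_pos h1 _) (Real.rpow_le_rpow h1.le
    (one_sub_norm_le_norm_one_sub hw) (by linarith))

theorem bergmanKernel_zero (α : ℝ) (z : ℂ) : bergmanKernel α z 0 = 1 := by
  simp [bergmanKernel]

theorem harmonicKernel_harmonic (α : ℝ) {z : ℂ} (hz : z ∈ Metric.ball (0 : ℂ) 1) :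
    HarmonicOnNhd (harmonicKernel α z) (Metric.ball 0 1) := by
  intro w hw
  have h := bergmanKernel_analyticAt α hz hw
  exact (h.harmonicAt.add h.harmonicAt_conj).sub (harmonicOnNhd_const 1 w (Set.mem_univ w))

theorem norm_harmonicKernel_le {α : ℝ} (z w : ℂ) :
    ‖harmonicKernel α z w‖ ≤ 2 * ‖bergmanKernel α z w‖ + 1 := by
  have h1 := norm_sub_le (bergmanKernel α z w + conj (bergmanKernel α z w)) 1
  have h2 := norm_add_le (bergmanKernel α z w) (conj (bergmanKernel α z w))
  rw [RCLike.norm_conj] at h2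
  rw [norm_one] at h1
  rw [harmonicKernel]
  linarith

/-- `|R_z|² ≤ B |K_z|²` with a constant independent of `z`, as `|K_z|` is bounded below. -/
theorem norm_harmonicKernel_sq_le {α : ℝ} (hα : -1 < α) {z w : ℂ}
    (hz : z ∈ Metric.ball (0 : ℂ) 1) (hw : w ∈ Metric.ball (0 : ℂ) 1) :
    ‖harmonicKernel α z w‖ ^ 2 ≤
      (2 + 2 ^ (2 + α)) ^ 2 * (((1 - ‖z‖ ^ 2) ^ (2 + α))⁻¹ * kernelDensity α z w) := by
  have h := norm_one_sub_pos hz hw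
  have h2 : ‖1 - conj z * w‖ ≤ 2 := by
    have h3 := norm_sub_le 1 (conj z * w)
    rw [norm_one, norm_mul, RCLike.norm_conj] at h3
    nlinarith [mem_ball_zero_iff.1 hz, mem_ball_zero_iff.1 hw, norm_nonneg z, norm_nonneg w]
  have h4 : 1 ≤ 2 ^ (2 + α) * ‖bergmanKernel α z w‖ := by
    rw [norm_bergmanKernel hz hw, ← div_eq_mul_inv, one_le_div (Real.rpow_pos_of_pos h _)]
    exact Real.rpow_le_rpow h.le h2 (by linarith)
  rw [← norm_bergmanKernel_sq hz hw, ← mul_pow]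
  refine pow_le_pow_left₀ (norm_nonneg _) ((norm_harmonicKernel_le z w).trans ?_) 2
  linarith

theorem norm_harmonicKernel_le_const {α : ℝ} (hα : -1 < α) {z w : ℂ}
    (hz : z ∈ Metric.ball (0 : ℂ) 1) (hw : w ∈ Metric.ball (0 : ℂ) 1) :
    ‖harmonicKernel α z w‖ ≤ 2 * ((1 - ‖z‖) ^ (2 + α))⁻¹ + 1 :=
  (norm_harmonicKernel_le z w).trans (by linarith [norm_bergmanKernel_le hα hz hw])

theorem memLp_harmonicKernel {α : ℝ} (hα : -1 < α) {z : ℂ} (hz : z ∈ Metric.ball (0 : ℂ) 1)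
    (p : ℝ≥0∞) : MemLp (harmonicKernel α z) p (weightedArea α) := by
  have := isProbabilityMeasure_weightedArea hα
  refine MemLp.of_bound (measurable_harmonicKernel α z).aestronglyMeasurable
    (2 * ((1 - ‖z‖) ^ (2 + α))⁻¹ + 1) ?_
  filter_upwards [ae_mem_ball α] with w hw using norm_harmonicKernel_le_const hα hz hw

theorem integral_bergmanKernel_pow {α : ℝ} (hα : -1 < α) {z : ℂ}
    (hz : z ∈ Metric.ball (0 : ℂ) 1) (n : ℕ) :
    Integrable (fun w => bergmanKernel α z w ^ n) (weightedArea α) ∧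
      ∫ w, bergmanKernel α z w ^ n ∂(weightedArea α) = 1 := by
  have := isProbabilityMeasure_weightedArea hα
  have hm : Measurable fun w => bergmanKernel α z w ^ n :=
    (measurable_bergmanKernel α z).pow_const n
  have hb : ∀ w ∈ Metric.ball (0 : ℂ) 1, ‖bergmanKernel α z w ^ n‖ ≤
      (((1 - ‖z‖) ^ (2 + α))⁻¹) ^ n := fun w hw => by
    rw [norm_pow]
    exact pow_le_pow_left₀ (norm_nonneg _) (norm_bergmanKernel_le hα hz hw) n
  constructor
  · refine Integrable.of_bound hm.aestronglyMeasurable ((((1 - ‖z‖) ^ (2 + α))⁻¹) ^ n) ?_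
    filter_upwards [ae_mem_ball α] with w hw using hb w hw
  · rw [integral_harmonic hα hm (fun w hw => ((bergmanKernel_analyticAt α hz hw).pow n).harmonicAt)
      hb, bergmanKernel_zero, one_pow]

theorem harmonicKernelNormSq_eq {α : ℝ} (hα : -1 < α) {z : ℂ}
    (hz : z ∈ Metric.ball (0 : ℂ) 1) :
    harmonicKernelNormSq α z = 2 / (1 - ‖z‖ ^ 2) ^ (2 + α) - 1 := by
  have := isProbabilityMeasure_weightedArea hα
  obtain ⟨i1, e1⟩ := integral_bergmanKernel_pow hα hz 1
  obtain ⟨i2, e2⟩ := integral_bergmanKernel_pow hα hz 2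
  obtain ⟨i3, e3⟩ := integral_kernelDensity hα hz
  simp only [pow_one] at i1 e1
  have r1 : ∫ w, (bergmanKernel α z w).re ∂(weightedArea α) = 1 := by
    have := integral_re i1
    simp only [RCLike.re_eq_complex_re] at this
    rw [this, e1, Complex.one_re]
  have r2 : ∫ w, (bergmanKernel α z w ^ 2).re ∂(weightedArea α) = 1 := by
    have := integral_re i2
    simp only [RCLike.re_eq_complex_re] at this
    rw [this, e2, Complex.one_re]
  have j1 := i1.re
  have j2 := i2.re
  simp only [RCLike.re_eq_complex_re] at j1 j2
  set s := ((1 - ‖z‖ ^ 2) ^ (2 + α))⁻¹ with hs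
  -- `R = 2 Re K - 1` is real, and `4 (Re K)² = 2 Re K² + 2 |K|²`
  have hpt : ∀ᵐ w ∂(weightedArea α), ‖harmonicKernel α z w‖ ^ 2 =
      2 * (bergmanKernel α z w ^ 2).re + 2 * (s * kernelDensity α z w)
        - 4 * (bergmanKernel α z w).re + 1 := by
    filter_upwards [ae_mem_ball α] with w hw
    rw [hs, ← norm_bergmanKernel_sq hz hw, harmonicKernel, ← Complex.normSq_eq_norm_sq,
      ← Complex.normSq_eq_norm_sq, Complex.normSq_apply, Complex.normSq_apply,
      sq (bergmanKernel _ _ _)]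
    simp
    ring
  have k1 : Integrable (fun w => 2 * (bergmanKernel α z w ^ 2).re) (weightedArea α) :=
    j2.const_mul 2
  have k2 : Integrable (fun w => 2 * (s * kernelDensity α z w)) (weightedArea α) :=
    (i3.const_mul s).const_mul 2
  have k3 : Integrable (fun w => 4 * (bergmanKernel α z w).re) (weightedArea α) :=
    j1.const_mul 4
  have k12 : Integrable (fun w => 2 * (bergmanKernel α z w ^ 2).re +
    2 * (s * kernelDensity α z w)) (weightedArea α) := k1.add k2
  have k123 : Integrable (fun w => 2 * (bergmanKernel α z w ^ 2).re +
    2 * (s * kernelDensity α z w) - 4 * (bergmanKernel α z w).re) (weightedArea α) := k12.sub k3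
  rw [harmonicKernelNormSq, integral_congr_ae hpt, integral_add k123 (integrable_const 1),
    integral_sub k12 k3, integral_add k1 k2, integral_const_mul,
    integral_const_mul, integral_const_mul, integral_const_mul, r1, r2, e3, integral_const]
  simp [div_eq_mul_inv, hs]
  ring

theorem harmonicKernel_self {α : ℝ} {z : ℂ} (hz : z ∈ Metric.ball (0 : ℂ) 1) :
    harmonicKernel α z z = ((2 / (1 - ‖z‖ ^ 2) ^ (2 + α) - 1 : ℝ) : ℂ) := by
  have hz1 := one_sub_norm_sq_pos hz
  have h2 : conj z * z = ((‖z‖ ^ 2 : ℝ) : ℂ) := by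
    rw [mul_comm, Complex.mul_conj, Complex.normSq_eq_norm_sq]
  have h : bergmanKernel α z z = ((1 / (1 - ‖z‖ ^ 2) ^ (2 + α) : ℝ) : ℂ) := by
    rw [bergmanKernel, h2, ← Complex.ofReal_one, ← Complex.ofReal_sub,
      ← Complex.ofReal_cpow hz1.le, ← Complex.ofReal_div]
  rw [harmonicKernel, h, Complex.conj_ofReal]
  push_cast
  ring

theorem inv_le_harmonicKernelNormSq {α : ℝ} (hα : -1 < α) {z : ℂ}
    (hz : z ∈ Metric.ball (0 : ℂ) 1) :
    ((1 - ‖z‖ ^ 2) ^ (2 + α))⁻¹ ≤ harmonicKernelNormSq α z := by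
  have hz1 := one_sub_norm_sq_pos hz
  have h1 : 1 ≤ ((1 - ‖z‖ ^ 2) ^ (2 + α))⁻¹ :=
    (one_le_inv₀ (Real.rpow_pos_of_pos hz1 _)).2
      (Real.rpow_le_one hz1.le (by nlinarith [sq_nonneg ‖z‖]) (by linarith))
  rw [harmonicKernelNormSq_eq hα hz, div_eq_mul_inv]
  linarith

theorem harmonicKernelNormSq_pos {α : ℝ} (hα : -1 < α) {z : ℂ}
    (hz : z ∈ Metric.ball (0 : ℂ) 1) : 0 < harmonicKernelNormSq α z :=
  (inv_pos.2 (Real.rpow_pos_of_pos (one_sub_norm_sq_pos hz) _)).trans_le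
    (inv_le_harmonicKernelNormSq hα hz)

theorem measurable_harmonicKernelNormSq {α : ℝ} (hα : -1 < α) :
    Measurable (harmonicKernelNormSq α) := by
  have := isProbabilityMeasure_weightedArea hα
  exact (StronglyMeasurable.integral_prod_right
    ((measurable_harmonicKernel_uncurry α).norm.pow_const 2).stronglyMeasurable).measurable

/-! ### Compactness for harmonic functions -/

/-- **Montel's theorem** on a disc, with pointwise convergence, by a diagonal argument for the
Taylor coefficients. -/
theorem exists_subseq_tendsto_of_bounded {r M : ℝ} (hr : 0 < r) {F : ℕ → ℂ → ℂ}
    (hF : ∀ k, DiffContOnCl ℂ (F k) (Metric.ball 0 r))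
    (hM : ∀ k, ∀ z ∈ Metric.sphere (0 : ℂ) r, ‖F k z‖ ≤ M) :
    ∃ φ : ℕ → ℕ, StrictMono φ ∧ ∃ G : ℂ → ℂ, DifferentiableOn ℂ G (Metric.ball 0 r) ∧
      ∀ z ∈ Metric.ball (0 : ℂ) r, Tendsto (fun k => F (φ k) z) atTop (𝓝 (G z)) := by
  set a : ℕ → ℕ → ℂ := fun k n => (n.factorial : ℂ)⁻¹ * iteratedDeriv n (F k) 0 with ha
  have hbd : ∀ k n, ‖a k n‖ ≤ M / r ^ n := by
    intro k n
    have h1 := Complex.norm_iteratedDeriv_le_of_forall_mem_sphere_norm_le n hr (hF k) (hM k)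
    have h2 : (0 : ℝ) < n.factorial := by exact_mod_cast n.factorial_pos
    rw [ha]
    simp only [norm_mul, norm_inv, Complex.norm_natCast]
    rw [inv_mul_le_iff₀ h2]
    exact h1.trans_eq (by ring)
  have hsum : ∀ k, ∀ z ∈ Metric.ball (0 : ℂ) r, HasSum (fun n => a k n * z ^ n) (F k z) := by
    intro k z hz
    have h := Complex.hasSum_taylorSeries_on_ball (hF k).differentiableOn hz
    refine h.congr_fun ?_
    intro n
    simp only [ha, sub_zero, smul_eq_mul]
    ring
  obtain ⟨b, hb, φ, hφ, hlim⟩ := (isCompact_univ_pi (s := fun n : ℕ =>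
    Metric.closedBall (0 : ℂ) (M / r ^ n)) fun n => isCompact_closedBall _ _).tendsto_subseq
    (x := a) (fun k n _ => by simpa using hbd k n)
  have hb' : ∀ n, ‖b n‖ ≤ M / r ^ n := fun n => by simpa using hb n (Set.mem_univ n)
  rw [tendsto_pi_nhds] at hlim
  have hsm : ∀ s, 0 ≤ s → s < r → Summable fun n : ℕ => M / r ^ n * s ^ n := by
    intro s hs hsr
    have h := (summable_geometric_of_lt_one (div_nonneg hs hr.le)
      ((div_lt_one hr).2 hsr)).mul_left M
    refine h.congr fun n => ?_
    rw [div_pow]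
    ring
  have hterm : ∀ c : ℂ, ∀ n : ℕ, ∀ s : ℝ, ∀ z : ℂ, ‖c‖ ≤ M / r ^ n → ‖z‖ ≤ s →
      ‖c * z ^ n‖ ≤ M / r ^ n * s ^ n := by
    intro c n s z hc hz
    rw [norm_mul, norm_pow]
    exact mul_le_mul hc (pow_le_pow_left₀ (norm_nonneg z) hz n) (by positivity)
      ((norm_nonneg c).trans hc)
  refine ⟨φ, hφ, fun z => ∑' n, b n * z ^ n, ?_, ?_⟩
  · intro z hz
    obtain ⟨s, hzs, hsr⟩ := exists_between (mem_ball_zero_iff.1 hz)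
    have hd := Complex.differentiableOn_tsum_of_summable_norm (U := Metric.ball (0 : ℂ) s)
      (F := fun n z => b n * z ^ n) (hsm s ((norm_nonneg z).trans hzs.le) hsr)
      (fun n => by fun_prop) Metric.isOpen_ball
      fun n w hw => hterm _ _ _ _ (hb' n) (mem_ball_zero_iff.1 hw).le
    exact (hd.differentiableAt (Metric.isOpen_ball.mem_nhds
      (mem_ball_zero_iff.2 hzs))).differentiableWithinAt
  · intro z hz
    have h : Tendsto (fun k => ∑' n, a (φ k) n * z ^ n) atTop (𝓝 (∑' n, b n * z ^ n)) :=
      tendsto_tsum_of_dominated_convergence (hsm ‖z‖ (norm_nonneg z) (mem_ball_zero_iff.1 hz))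
        (fun n => (hlim n).mul_const _)
        (Eventually.of_forall fun k n => hterm _ _ _ _ (hbd _ n) le_rfl)
    simpa only [(hsum _ z hz).tsum_eq] using h

/-- A bounded real harmonic function on a disc is the real part of a holomorphic function, which
by the Borel-Carathéodory theorem is bounded on smaller discs. -/
theorem exists_holomorphic_re_eq_and_norm_le {u : ℂ → ℝ} {R r M : ℝ} (hr : 0 < r) (hrR : r < R)
    (hM0 : 0 < M) (hu : HarmonicOnNhd u (Metric.ball 0 R))
    (hM : ∀ w ∈ Metric.ball (0 : ℂ) R, |u w| ≤ M) :
    ∃ F : ℂ → ℂ, DifferentiableOn ℂ F (Metric.ball 0 R) ∧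
      (∀ w ∈ Metric.ball (0 : ℂ) R, (F w).re = u w) ∧
      ∀ w ∈ Metric.closedBall (0 : ℂ) r, ‖F w‖ ≤ 4 * M * R / (R - r) := by
  obtain ⟨F, hF, hre⟩ := hu.exists_analyticOnNhd_ball_re_eq
  have hR : 0 < R := hr.trans hrR
  have hRr : 0 < R - r := by linarith
  have h0 : (0 : ℂ) ∈ Metric.ball (0 : ℂ) R := Metric.mem_ball_self hR
  -- normalised to be real at the centre, so that `u` controls its value there
  set F' : ℂ → ℂ := fun w => F w - ((F 0).im : ℂ) * Complex.I with hF'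
  have hd : DifferentiableOn ℂ F' (Metric.ball 0 R) := hF.differentiableOn.sub_const _
  have hre' : ∀ w ∈ Metric.ball (0 : ℂ) R, (F' w).re = u w := fun w hw => by
    rw [← hre hw]
    simp [hF']
  refine ⟨F', hd, hre', fun w hw => ?_⟩
  have hw' : ‖w‖ ≤ r := mem_closedBall_zero_iff.1 hw
  have hF0 : ‖F' 0‖ ≤ M := by
    have : F' 0 = ((u 0 : ℝ) : ℂ) := by
      rw [← hre h0]
      apply Complex.ext <;> simp [hF']
    rw [this, Complex.norm_real]
    exact hM 0 h0
  have h1 := Complex.borelCaratheodory hM0 hd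
    (fun x hx => by
      have := (abs_le.1 (hM x hx)).2
      rwa [← hre' x hx] at this) hR
    (z := w) (mem_ball_zero_iff.2 (hw'.trans_lt hrR))
  refine h1.trans ?_
  have h2 : 0 < R - ‖w‖ := by linarith
  rw [← add_div]
  refine div_le_div₀ (by positivity) ?_ hRr (by linarith)
  nlinarith [norm_nonneg w, norm_nonneg (F' 0)]

/-- A real analytic function on a disc that does not vanish at the centre is almost everywhere
nonzero: on every ray from the centre its zeros are isolated. -/
theorem ae_ne_zero_of_analytic {u : ℂ → ℂ} {r : ℝ} (hr : 0 < r)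
    (hu : AnalyticOnNhd ℝ u (Metric.ball 0 r)) (h0 : u 0 ≠ 0) :
    ∀ᵐ z : ℂ, z ∈ Metric.ball (0 : ℂ) r → u z ≠ 0 := by
  set Z : Set ℂ := Metric.ball 0 r \ (Metric.ball 0 r ∩ u ⁻¹' {0}ᶜ) with hZ
  have hZm : MeasurableSet Z := Metric.isOpen_ball.measurableSet.diff
    (hu.continuousOn.isOpen_inter_preimage Metric.isOpen_ball
      isOpen_compl_singleton).measurableSet
  have hmem : ∀ z, z ∈ Z ↔ z ∈ Metric.ball (0 : ℂ) r ∧ u z = 0 := by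
    intro z
    simp only [hZ, Set.mem_sdiff, Set.mem_inter_iff, Set.mem_preimage, Set.mem_compl_iff,
      Set.mem_singleton_iff]
    tauto
  have hZ0 : volume Z = 0 := by
    rw [← lintegral_indicator_one hZm, ← Complex.lintegral_comp_polarCoord_symm]
    have hpm : Measurable fun p : ℝ × ℝ => Complex.polarCoord.symm p := by
      simp only [Complex.polarCoord_symm_apply]
      fun_prop
    have hm : Measurable fun p : ℝ × ℝ =>
        ENNReal.ofReal p.1 • Z.indicator (1 : ℂ → ℝ≥0∞) (Complex.polarCoord.symm p) := by
      simp only [smul_eq_mul]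
      exact (ENNReal.measurable_ofReal.comp measurable_fst).mul
        ((measurable_one.indicator hZm).comp hpm)
    rw [polarCoord_target, Measure.volume_eq_prod, ← Measure.prod_restrict,
      lintegral_prod_symm _ hm.aemeasurable]
    refine (lintegral_congr fun θ => ?_).trans lintegral_zero
    -- the restriction of `u` to the ray with angle `θ`
    set e : ℂ := Complex.cos θ + Complex.sin θ * Complex.I with he
    have hen : ‖e‖ = 1 := by
      rw [he, ← Complex.exp_mul_I, Complex.norm_exp_ofReal_mul_I]
    have hball : ∀ t ∈ Set.Ioo (-r) r, (t : ℂ) * e ∈ Metric.ball (0 : ℂ) r := by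
      intro t ht
      rw [mem_ball_zero_iff, norm_mul, hen, mul_one, Complex.norm_real, Real.norm_eq_abs]
      exact abs_lt.2 ht
    have hv : AnalyticOnNhd ℝ (fun t : ℝ => u ((t : ℂ) * e)) (Set.Ioo (-r) r) := by
      intro t ht
      have h1 : AnalyticAt ℝ (fun t : ℝ => (t : ℂ) * e) t :=
        (Complex.ofRealCLM.analyticAt t).mul analyticAt_const
      exact AnalyticAt.fun_comp (hu _ (hball t ht)) h1
    have hcod := hv.preimage_zero_mem_codiscreteWithin (x := 0) (by simpa using h0)
      ⟨by linarith, hr⟩ (isConnected_Ioo (by linarith))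
    have hae := ae_restrict_le_codiscreteWithin (μ := (volume : Measure ℝ)) measurableSet_Ioo hcod
    have hae' : ∀ᵐ t : ℝ, t ∈ Set.Ioo (-r) r → u ((t : ℂ) * e) ≠ 0 := ae_imp_of_ae_restrict hae
    refine (lintegral_congr_ae (g := 0) ?_).trans lintegral_zero
    refine ae_restrict_of_ae ?_
    filter_upwards [hae'] with t ht
    have : Complex.polarCoord.symm (t, θ) ∉ Z := by
      rw [hmem, Complex.polarCoord_symm_apply]
      rintro ⟨h1, h2⟩
      rw [mem_ball_zero_iff, norm_mul, Complex.norm_real, Real.norm_eq_abs] at h1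
      simp only [Complex.ofReal_cos, Complex.ofReal_sin] at h1 h2
      rw [← he, hen, mul_one] at h1
      exact ht (abs_lt.1 h1) h2
    rw [Set.indicator_of_notMem this, smul_zero]
    rfl
  filter_upwards [measure_eq_zero_iff_ae_notMem.1 hZ0] with z hz h1 h2
  exact hz ((hmem z).2 ⟨h1, h2⟩)

theorem enorm_le_one_add_sq (x : ℝ≥0∞) : x ≤ 1 + x ^ 2 := by
  rcases le_total x 1 with h | h
  · exact h.trans le_self_add
  · refine le_trans ?_ le_add_self
    rw [sq]
    exact le_mul_of_one_le_left' h

/-- A bound for the mean square on a disc bounds a harmonic function on smaller discs; the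
inequality `|h| ≤ 1 + |h|²` takes the place of the Cauchy-Schwarz inequality. -/
theorem exists_norm_le_of_lintegral_le {α : ℝ} (hα : -1 < α) {r R : ℝ} (hr : r < R) (hR : R < 1)
    {M : ℝ≥0∞} (hM : M ≠ ∞) :
    ∃ C : ℝ, 0 < C ∧ ∀ h : ℂ → ℂ, HarmonicOnNhd h (Metric.ball 0 1) →
      ∫⁻ w in Metric.ball 0 R, ‖h w‖ₑ ^ 2 ∂(weightedArea α) ≤ M →
      ∀ c ∈ Metric.closedBall (0 : ℂ) r, ‖h c‖ ≤ C := by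
  have := isProbabilityMeasure_weightedArea hα
  obtain ⟨K, hK, hle⟩ := volume_restrict_le hα hR
  have hδ : 0 < R - r := by linarith
  set a := ENNReal.ofReal (Real.pi * (R - r) ^ 2)
  have ha0 : a ≠ 0 := by simpa [a] using mul_pos Real.pi_pos (pow_pos hδ 2)
  set B := a⁻¹ * (K * (1 + M)) with hB
  have hBtop : B ≠ ∞ := ENNReal.mul_ne_top (ENNReal.inv_ne_top.2 ha0)
    (ENNReal.mul_ne_top hK (ENNReal.add_ne_top.2 ⟨ENNReal.one_ne_top, hM⟩))
  refine ⟨B.toReal + 1, by positivity, fun h hh hint c hc => ?_⟩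
  have hc' : ‖c‖ ≤ r := mem_closedBall_zero_iff.1 hc
  have hsub : Metric.ball c (R - r) ⊆ Metric.ball 0 R := by
    apply Metric.ball_subset_ball'
    rw [dist_zero_right]
    linarith
  have hle' : volume.restrict (Metric.ball (0 : ℂ) R) ≤
      K • (weightedArea α).restrict (Metric.ball 0 R) := by
    have h1 := Measure.restrict_mono (le_refl (Metric.ball (0 : ℂ) R)) hle
    rwa [Measure.restrict_restrict Metric.isOpen_ball.measurableSet, Set.inter_self,
      Measure.restrict_smul] at h1
  have h1 : a * ‖h c‖ₑ ≤ K * (1 + M) := by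
    calc a * ‖h c‖ₑ ≤ ∫⁻ z in Metric.ball c (R - r), ‖h z‖ₑ :=
          enorm_le_lintegral_ball hδ (hh.mono (hsub.trans (Metric.ball_subset_ball hR.le)))
      _ ≤ ∫⁻ z in Metric.ball 0 R, ‖h z‖ₑ := lintegral_mono_set hsub
      _ ≤ ∫⁻ z in Metric.ball 0 R, (1 + ‖h z‖ₑ ^ 2) :=
          lintegral_mono fun z => enorm_le_one_add_sq _
      _ ≤ ∫⁻ z, (1 + ‖h z‖ₑ ^ 2) ∂(K • (weightedArea α).restrict (Metric.ball 0 R)) :=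
          lintegral_mono' hle' le_rfl
      _ ≤ K * (1 + M) := by
          rw [lintegral_smul_measure, lintegral_add_left measurable_const, lintegral_one,
            smul_eq_mul]
          gcongr
          rw [Measure.restrict_apply_univ]
          exact prob_le_one
  have h2 : ‖h c‖ₑ ≤ B := by
    calc ‖h c‖ₑ = a⁻¹ * (a * ‖h c‖ₑ) := by
          rw [← mul_assoc, ENNReal.inv_mul_cancel ha0 ENNReal.ofReal_ne_top, one_mul]
      _ ≤ B := mul_le_mul' le_rfl h1
  have h3 := ENNReal.toReal_mono hBtop h2
  rw [toReal_enorm] at h3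
  linarith

theorem weightedArea_absolutelyContinuous (α : ℝ) : weightedArea α ≪ volume :=
  (withDensity_absolutelyContinuous _ _).trans
    ((Measure.smul_absolutelyContinuous).trans Measure.restrict_le_self.absolutelyContinuous)

/-- Harmonic functions that are bounded in mean square and of modulus at least `1` at the
centre have uniformly small sublevel sets. Otherwise there would be a pointwise convergent sequence
of such functions whose limit is harmonic and vanishes on a set of positive measure. -/
theorem exists_measure_sublevel_le {α : ℝ} (hα : -1 < α) {ρ R : ℝ} (hρ : 0 < ρ) (hρR : ρ < R)
    (hR : R < 1) {M δ : ℝ≥0∞} (hM : M ≠ ∞) (hδ : 0 < δ) :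
    ∃ η : ℝ, 0 < η ∧ ∀ h : ℂ → ℂ, HarmonicOnNhd h (Metric.ball 0 1) → 1 ≤ ‖h 0‖ →
      ∫⁻ w in Metric.ball 0 R, ‖h w‖ₑ ^ 2 ∂(weightedArea α) ≤ M →
      weightedArea α {w | w ∈ Metric.ball (0 : ℂ) ρ ∧ ‖h w‖ < η} ≤ δ := by
  have := isProbabilityMeasure_weightedArea hα
  by_contra! hcon
  choose h hh h1 hint hlt using fun k : ℕ => hcon (1 / ((k : ℝ) + 1)) (by positivity)
  obtain ⟨r₁, hr₁, hr₁R⟩ := exists_between hρR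
  obtain ⟨r₂, hr₂, hr₂R⟩ := exists_between hr₁R
  have hr₁0 : 0 < r₁ := hρ.trans hr₁
  obtain ⟨C, hC0, hC⟩ := exists_norm_le_of_lintegral_le hα hr₂R hR hM
  have hbd : ∀ k, ∀ w ∈ Metric.ball (0 : ℂ) r₂, ‖h k w‖ ≤ C := fun k w hw =>
    hC (h k) (hh k) (hint k) w (Metric.ball_subset_closedBall hw)
  have hsub : Metric.ball (0 : ℂ) r₂ ⊆ Metric.ball 0 1 :=
    Metric.ball_subset_ball (by linarith)
  choose F hFd hFre hFb using fun k => exists_holomorphic_re_eq_and_norm_le hr₁0 hr₂ hC0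
    (((hh k).mono hsub).comp_CLM Complex.reCLM)
    fun w hw => (Complex.abs_re_le_norm _).trans (hbd k w hw)
  choose G hGd hGre hGb using fun k => exists_holomorphic_re_eq_and_norm_le hr₁0 hr₂ hC0
    (((hh k).mono hsub).comp_CLM Complex.imCLM)
    fun w hw => (Complex.abs_im_le_norm _).trans (hbd k w hw)
  have hcl : ∀ {f : ℂ → ℂ}, DifferentiableOn ℂ f (Metric.ball 0 r₂) →
      DiffContOnCl ℂ f (Metric.ball 0 r₁) := fun hf =>
    (hf.mono (Metric.closedBall_subset_ball hr₂)).diffContOnCl_ball le_rfl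
  obtain ⟨φ, hφ, F₀, hF₀, hF₀lim⟩ := exists_subseq_tendsto_of_bounded hr₁0
    (fun k => hcl (hFd k)) fun k z hz => hFb k z (Metric.sphere_subset_closedBall hz)
  obtain ⟨ψ, hψ, G₀, hG₀, hG₀lim⟩ := exists_subseq_tendsto_of_bounded hr₁0
    (fun k => hcl (hGd (φ k))) fun k z hz => hGb (φ k) z (Metric.sphere_subset_closedBall hz)
  set u : ℂ → ℂ := fun z => ((F₀ z).re : ℂ) + ((G₀ z).re : ℂ) * Complex.I with hu
  have hlim : ∀ z ∈ Metric.ball (0 : ℂ) r₁,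
      Tendsto (fun k => h (φ (ψ k)) z) atTop (𝓝 (u z)) := by
    intro z hz
    have hz2 : z ∈ Metric.ball (0 : ℂ) r₂ := Metric.ball_subset_ball hr₂.le hz
    have l1 := (Complex.continuous_ofReal.comp Complex.continuous_re).continuousAt.tendsto.comp
      ((hF₀lim z hz).comp hψ.tendsto_atTop)
    have l2 := (Complex.continuous_ofReal.comp Complex.continuous_re).continuousAt.tendsto.comp
      (hG₀lim z hz)
    refine (l1.add (l2.mul_const Complex.I)).congr fun k => ?_
    simp only [Function.comp_apply]
    rw [hFre _ z hz2, hGre _ z hz2]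
    exact Complex.re_add_im _
  have hua : AnalyticOnNhd ℝ u (Metric.ball 0 r₁) := by
    intro z hz
    have a1 : AnalyticAt ℝ F₀ z :=
      ((hF₀.analyticOnNhd Metric.isOpen_ball) z hz).restrictScalars
    have a2 : AnalyticAt ℝ G₀ z :=
      ((hG₀.analyticOnNhd Metric.isOpen_ball) z hz).restrictScalars
    have a3 := fun v => (Complex.ofRealCLM.comp Complex.reCLM).analyticAt v
    exact ((a3 _).fun_comp a1).add (((a3 _).fun_comp a2).mul analyticAt_const)
  have hu0 : u 0 ≠ 0 := by
    have := ge_of_tendsto' (hlim 0 (Metric.mem_ball_self hr₁0)).norm fun k => h1 (φ (ψ k))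
    exact norm_pos_iff.1 (by linarith)
  have hae := (weightedArea_absolutelyContinuous α).ae_le (ae_ne_zero_of_analytic hr₁0 hua hu0)
  set A : ℕ → Set ℂ := fun k =>
    {w | w ∈ Metric.ball (0 : ℂ) ρ ∧ ‖h (φ (ψ k)) w‖ < 1 / (((φ (ψ k) : ℕ) : ℝ) + 1)} with hA
  have hAm : ∀ k, MeasurableSet (A k) := by
    intro k
    have hc : ContinuousOn (fun w => ‖h (φ (ψ k)) w‖) (Metric.ball 0 ρ) :=
      ((hh _).continuousOn.mono (Metric.ball_subset_ball (by linarith))).norm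
    exact (hc.isOpen_inter_preimage Metric.isOpen_ball
      (isOpen_Iio (a := 1 / (((φ (ψ k) : ℕ) : ℝ) + 1)))).measurableSet
  have hz : Tendsto (fun k => weightedArea α (A k)) atTop (𝓝 (weightedArea α ∅)) := by
    refine tendsto_measure_of_ae_tendsto_indicator_of_isFiniteMeasure atTop MeasurableSet.empty
      hAm ?_
    filter_upwards [hae] with w hw
    by_cases hwρ : w ∈ Metric.ball (0 : ℂ) ρ
    · have hw1 : w ∈ Metric.ball (0 : ℂ) r₁ := Metric.ball_subset_ball hr₁.le hwρ
      have l1 := (hlim w hw1).norm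
      have l2 : Tendsto (fun k => 1 / (((φ (ψ k) : ℕ) : ℝ) + 1)) atTop (𝓝 0) :=
        tendsto_one_div_add_atTop_nhds_zero_nat.comp (hφ.comp hψ).tendsto_atTop
      filter_upwards [l2.eventually_lt l1 (norm_pos_iff.2 (hw hw1))] with k hk
      simp only [hA, Set.mem_ofPred_eq, Set.mem_empty_iff_false, iff_false, not_and, not_lt]
      exact fun _ => hk.le
    · exact Eventually.of_forall fun k => iff_of_false (fun h => hwρ h.1) (by simp)
  rw [measure_empty] at hz
  exact absurd (ge_of_tendsto' hz fun k => (hlt (φ (ψ k))).le) (not_le.2 hδ)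

/-- Harmonicity is invariant under disc automorphisms. -/
theorem harmonic_comp_moebius {g : ℂ → ℂ} (hg : HarmonicOnNhd g (Metric.ball 0 1)) {z : ℂ}
    (hz : z ∈ Metric.ball (0 : ℂ) 1) :
    HarmonicOnNhd (fun w => g (moebius z w)) (Metric.ball 0 1) := by
  have key : ∀ u : ℂ → ℝ, HarmonicOnNhd u (Metric.ball 0 1) →
      HarmonicOnNhd (fun w => u (moebius z w)) (Metric.ball 0 1) := by
    intro u hu w hw
    obtain ⟨F, hF, hre⟩ := hu.exists_analyticOnNhd_ball_re_eq
    have hd : DifferentiableOn ℂ (moebius z) (Metric.ball 0 1) := fun v hv =>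
      (hasDerivAt_moebius hz hv).differentiableAt.differentiableWithinAt
    have ha : AnalyticAt ℂ (fun w => F (moebius z w)) w :=
      AnalyticAt.fun_comp (hF _ (moebius_mem_ball hz hw))
        (hd.analyticOnNhd Metric.isOpen_ball w hw)
    refine (harmonicAt_congr_nhds ?_).2 ha.harmonicAt_re
    filter_upwards [Metric.isOpen_ball.mem_nhds hw] with v hv
    exact (hre (moebius_mem_ball hz hv)).symm
  have hre := key _ (hg.comp_CLM Complex.reCLM)
  have him := key _ (hg.comp_CLM Complex.imCLM)
  have h := (hre.comp_CLM Complex.ofRealCLM).add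
    (him.comp_CLM ((ContinuousLinearMap.mul ℝ ℂ Complex.I).comp Complex.ofRealCLM))
  convert h using 1
  ext w
  simp [mul_comm Complex.I, Complex.re_add_im]

/-! ### Reverse Carleson measures -/

theorem exists_measure_compl_ball_le {α : ℝ} (hα : -1 < α) {δ : ℝ≥0∞} (hδ : 0 < δ) :
    ∃ ρ : ℝ, 0 < ρ ∧ ρ < 1 ∧ weightedArea α (Metric.ball 0 ρ)ᶜ ≤ δ := by
  have := isProbabilityMeasure_weightedArea hα
  have hlim : Tendsto (fun n : ℕ => 1 - 1 / ((n : ℝ) + 1)) atTop (𝓝 1) := by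
    simpa using tendsto_one_div_add_atTop_nhds_zero_nat.const_sub (1 : ℝ)
  have h : Tendsto (fun n : ℕ => weightedArea α (Metric.ball 0 (1 - 1 / ((n : ℝ) + 1)))ᶜ) atTop
      (𝓝 (weightedArea α ∅)) := by
    refine tendsto_measure_of_ae_tendsto_indicator_of_isFiniteMeasure atTop MeasurableSet.empty
      (fun _ => Metric.isOpen_ball.measurableSet.compl) ?_
    filter_upwards [ae_mem_ball α] with w hw
    filter_upwards [hlim.eventually_const_lt (mem_ball_zero_iff.1 hw)] with n hn
    exact iff_of_false (fun h => h (mem_ball_zero_iff.2 hn)) (by simp)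
  rw [measure_empty] at h
  obtain ⟨n, hn, hn0⟩ := ((h.eventually_lt_const hδ).and
    (hlim.eventually_const_lt one_pos)).exists
  exact ⟨_, hn0, by
    have : (0 : ℝ) < 1 / ((n : ℝ) + 1) := by positivity
    linarith, hn.le⟩

/-- If the image of `ω_α dA` under almost every `moebius z` gives `G` at least the mass `δ`, then
`|f|²` is controlled by its integral over `G`, for all square integrable harmonic `f`.

For almost every point `z`, either `|f z|²` is small compared to the average of `|f|²` over a
large pseudohyperbolic disc about `z`, or compactness applies to `f ∘ moebius z / f z` and bounds
`|f z|²` by the integral of `|f|²` over the part of `G` in a pseudohyperbolic disc. -/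
theorem exists_lintegral_le_setLIntegral {α : ℝ} (hα : -1 < α) {G : Set ℂ} (hG : MeasurableSet G)
    {δ : ℝ≥0∞} (hδ : 0 < δ)
    (hthick : ∀ᵐ z ∂(weightedArea α), δ ≤ weightedArea α (moebius z ⁻¹' G)) :
    ∃ C : ℝ≥0∞, C ≠ ∞ ∧ ∀ g : ℂ → ℂ, HarmonicOnNhd g (Metric.ball 0 1) →
      ∫⁻ z, ‖g z‖ₑ ^ 2 ∂(weightedArea α) ≠ ∞ →
      ∫⁻ z, ‖g z‖ₑ ^ 2 ∂(weightedArea α) ≤ C * ∫⁻ z in G, ‖g z‖ₑ ^ 2 ∂(weightedArea α) := by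
  have := isProbabilityMeasure_weightedArea hα
  wlog hδ1 : δ ≤ 1 generalizing δ
  · refine this (δ := min δ 1) (lt_min hδ one_pos) ?_ (min_le_right _ _)
    filter_upwards [hthick] with z hz using (min_le_left _ _).trans hz
  have hδtop : δ ≠ ∞ := (hδ1.trans_lt ENNReal.one_lt_top).ne
  have hδ3 : 0 < δ / 3 := ENNReal.div_pos hδ.ne' (by norm_num)
  have hδ3top : δ / 3 ≠ ∞ := (ENNReal.div_lt_top hδtop (by norm_num)).ne
  obtain ⟨ρ, hρ0, hρ1, hρ⟩ := exists_measure_compl_ball_le hα hδ3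
  obtain ⟨R, hρR, hR1⟩ := exists_between hρ1
  obtain ⟨CR, hCR, hSR⟩ := lintegral_lintegral_comp_moebius_le hα hR1
  obtain ⟨Cρ, hCρ, hSρ⟩ := lintegral_lintegral_comp_moebius_le hα hρ1
  -- chosen so that the bad points contribute at most half of `∫ |g|²`
  set ε : ℝ≥0∞ := (2 * (CR + 1))⁻¹ with hε
  have hd0 : 2 * (CR + 1) ≠ 0 := by simp
  have hdtop : 2 * (CR + 1) ≠ ∞ :=
    ENNReal.mul_ne_top (by simp) (ENNReal.add_ne_top.2 ⟨hCR, ENNReal.one_ne_top⟩)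
  obtain ⟨η, hη0, hη⟩ := exists_measure_sublevel_le hα hρ0 hρR hR1 hdtop hδ3
  set c : ℝ≥0∞ := ENNReal.ofReal η ^ 2 * (δ / 3) with hc
  have hc0 : c ≠ 0 := mul_ne_zero (pow_ne_zero 2 (by simpa using hη0)) hδ3.ne'
  have hctop : c ≠ ∞ := ENNReal.mul_ne_top (ENNReal.pow_ne_top ENNReal.ofReal_ne_top) hδ3top
  refine ⟨2 * (c⁻¹ * Cρ), ENNReal.mul_ne_top (by simp)
    (ENNReal.mul_ne_top (ENNReal.inv_ne_top.2 hc0) hCρ), fun g hg hfin => ?_⟩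
  -- outside the disc `g` need not be measurable
  set g₀ : ℂ → ℂ := (Metric.ball 0 1).indicator g with hg₀
  have hg₀m : Measurable g₀ := by
    classical
    rw [hg₀, ← Set.piecewise_eq_indicator]
    exact ContinuousOn.measurable_piecewise hg.continuousOn continuousOn_const
      Metric.isOpen_ball.measurableSet
  have hg₀eq : ∀ z ∈ Metric.ball (0 : ℂ) 1, g₀ z = g z := fun z hz =>
    Set.indicator_of_mem hz g
  have hqm : Measurable fun u => ‖g₀ u‖ₑ ^ 2 := hg₀m.enorm.pow_const 2
  have hqGm : Measurable (G.indicator fun u => ‖g₀ u‖ₑ ^ 2) := hqm.indicator hG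
  have hae₀ : (fun u => ‖g₀ u‖ₑ ^ 2) =ᵐ[weightedArea α] fun u => ‖g u‖ₑ ^ 2 := by
    filter_upwards [ae_mem_ball α] with u hu
    rw [hg₀eq u hu]
  have hpt : ∀ᵐ z ∂(weightedArea α), ‖g z‖ₑ ^ 2 ≤
      ε * ∫⁻ w in Metric.ball 0 R, ‖g₀ (moebius z w)‖ₑ ^ 2 ∂(weightedArea α) +
      c⁻¹ * ∫⁻ w in Metric.ball 0 ρ, G.indicator (fun u => ‖g₀ u‖ₑ ^ 2) (moebius z w)
        ∂(weightedArea α) := by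
    filter_upwards [ae_mem_ball α, hthick] with z hz hzG
    rcases le_or_gt (‖g z‖ₑ ^ 2)
      (ε * ∫⁻ w in Metric.ball 0 R, ‖g₀ (moebius z w)‖ₑ ^ 2 ∂(weightedArea α)) with hle | hgt
    · exact hle.trans le_self_add
    refine le_trans ?_ le_add_self
    have hgz : g z ≠ 0 := by
      rintro h0
      simp [h0] at hgt
    have hgz0 : ‖g z‖ₑ ^ 2 ≠ 0 := pow_ne_zero 2 (enorm_ne_zero.2 hgz)
    have hgztop : ‖g z‖ₑ ^ 2 ≠ ∞ := ENNReal.pow_ne_top enorm_ne_top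
    set h : ℂ → ℂ := fun w => (g z)⁻¹ * g (moebius z w) with hh
    have hharm : HarmonicOnNhd h (Metric.ball 0 1) :=
      (harmonic_comp_moebius hg hz).comp_CLM (ContinuousLinearMap.mul ℝ ℂ (g z)⁻¹)
    have hh0 : 1 ≤ ‖h 0‖ := by
      simp [hh, moebius_zero, hgz]
    have hhsq : ∀ w ∈ Metric.ball (0 : ℂ) 1,
        ‖h w‖ₑ ^ 2 = (‖g z‖ₑ ^ 2)⁻¹ * ‖g₀ (moebius z w)‖ₑ ^ 2 := by
      intro w hw
      rw [hg₀eq _ (moebius_mem_ball hz hw), hh, enorm_mul, enorm_inv hgz, mul_pow, ENNReal.inv_pow]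
    have hcm : Measurable fun w => ‖g₀ (moebius z w)‖ₑ ^ 2 := hqm.comp (measurable_moebius z)
    have hint : ∫⁻ w in Metric.ball 0 R, ‖h w‖ₑ ^ 2 ∂(weightedArea α) ≤ 2 * (CR + 1) := by
      rw [setLIntegral_congr_fun Metric.isOpen_ball.measurableSet fun w hw =>
        hhsq w (Metric.ball_subset_ball hR1.le hw),
        lintegral_const_mul _ hcm,
        ENNReal.inv_mul_le_iff hgz0 hgztop, mul_comm, ← ENNReal.inv_mul_le_iff hd0 hdtop]
      exact hgt.le
    -- the part of `G`, seen from `z`, on which `h` is not small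
    set E : Set ℂ := moebius z ⁻¹' G ∩ Metric.ball 0 ρ with hE
    have hEm : MeasurableSet E :=
      (measurable_moebius z hG).inter Metric.isOpen_ball.measurableSet
    set S : Set ℂ := {w | w ∈ Metric.ball (0 : ℂ) ρ ∧ ‖h w‖ < η} with hS
    have hSm : MeasurableSet S :=
      ((hharm.continuousOn.mono (Metric.ball_subset_ball hρ1.le)).norm.isOpen_inter_preimage
        Metric.isOpen_ball (isOpen_Iio (a := η))).measurableSet
    have hmass : δ / 3 ≤ weightedArea α (E \ S) := by
      have h1 : δ ≤ weightedArea α (E \ S) + δ / 3 + δ / 3 := by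
        calc δ ≤ weightedArea α (moebius z ⁻¹' G) := hzG
          _ ≤ weightedArea α ((E \ S ∪ S) ∪ (Metric.ball 0 ρ)ᶜ) := by
              refine measure_mono fun w hw => ?_
              by_cases h1 : w ∈ Metric.ball (0 : ℂ) ρ
              · by_cases h2 : w ∈ S
                · exact Or.inl (Or.inr h2)
                · exact Or.inl (Or.inl ⟨⟨hw, h1⟩, h2⟩)
              · exact Or.inr h1
          _ ≤ _ := (measure_union_le _ _).trans (add_le_add ((measure_union_le _ _).trans
              (add_le_add le_rfl (hη h hharm hh0 hint))) hρ)
      have h2 : δ = δ / 3 + (δ / 3 + δ / 3) := by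
        rw [← add_assoc, ENNReal.add_thirds]
      have h3 : δ / 3 + (δ / 3 + δ / 3) ≤ weightedArea α (E \ S) + (δ / 3 + δ / 3) := by
        rw [← h2, ← add_assoc]
        exact h1
      exact (ENNReal.add_le_add_iff_right (ENNReal.add_ne_top.2 ⟨hδ3top, hδ3top⟩)).1 h3
    rw [← ENNReal.div_eq_inv_mul, ENNReal.le_div_iff_mul_le (Or.inl hc0) (Or.inl hctop)]
    have hlow : c ≤ ∫⁻ w in E \ S, ‖h w‖ₑ ^ 2 ∂(weightedArea α) := by
      calc c ≤ ENNReal.ofReal η ^ 2 * weightedArea α (E \ S) := mul_le_mul' le_rfl hmass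
        _ = ∫⁻ _ in E \ S, ENNReal.ofReal η ^ 2 ∂(weightedArea α) := by rw [setLIntegral_const]
        _ ≤ _ := by
            refine setLIntegral_mono' (hEm.diff hSm) fun w hw => ?_
            have : η ≤ ‖h w‖ := not_lt.1 fun hlt => hw.2 ⟨hw.1.2, hlt⟩
            rw [← ofReal_norm]
            gcongr
    calc ‖g z‖ₑ ^ 2 * c ≤ ‖g z‖ₑ ^ 2 * ∫⁻ w in E \ S, ‖h w‖ₑ ^ 2 ∂(weightedArea α) := by
          gcongr
      _ = ∫⁻ w in E \ S, ‖g₀ (moebius z w)‖ₑ ^ 2 ∂(weightedArea α) := by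
          rw [setLIntegral_congr_fun (hEm.diff hSm) fun w hw =>
            hhsq w (Metric.ball_subset_ball hρ1.le hw.1.2),
            lintegral_const_mul _ hcm, ← mul_assoc,
            ENNReal.mul_inv_cancel hgz0 hgztop, one_mul]
      _ = ∫⁻ w in E \ S, G.indicator (fun u => ‖g₀ u‖ₑ ^ 2) (moebius z w) ∂(weightedArea α) :=
          setLIntegral_congr_fun (hEm.diff hSm) fun w hw =>
            (Set.indicator_of_mem (f := fun u => ‖g₀ u‖ₑ ^ 2)
              (show moebius z w ∈ G from hw.1.1)).symm
      _ ≤ _ := lintegral_mono_set fun w hw => hw.1.2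
  set N := ∫⁻ z, ‖g z‖ₑ ^ 2 ∂(weightedArea α) with hN
  have hmQ : ∀ (s : ℝ) (q : ℂ → ℝ≥0∞), Measurable q → Measurable fun z =>
      ∫⁻ w in Metric.ball 0 s, q (moebius z w) ∂(weightedArea α) := fun s q hq =>
    Measurable.lintegral_prod_right' (f := fun p : ℂ × ℂ => q (moebius p.1 p.2))
      (hq.comp measurable_moebius_uncurry)
  have hmain : N ≤ ε * (CR * N) + c⁻¹ * (Cρ * ∫⁻ z in G, ‖g z‖ₑ ^ 2 ∂(weightedArea α)) := by
    refine (lintegral_mono_ae hpt).trans ?_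
    rw [lintegral_add_left ((hmQ R _ hqm).const_mul ε), lintegral_const_mul _ (hmQ R _ hqm),
      lintegral_const_mul _ (hmQ ρ _ hqGm)]
    refine add_le_add (mul_le_mul' le_rfl ?_) (mul_le_mul' le_rfl ?_)
    · rw [hN, ← lintegral_congr_ae hae₀]
      exact hSR _ hqm
    · rw [← lintegral_congr_ae (ae_restrict_of_ae hae₀), ← lintegral_indicator hG]
      exact hSρ _ hqGm
  have hhalf : ε * (CR * N) ≤ N / 2 := by
    rw [← mul_assoc, ENNReal.div_eq_inv_mul]
    gcongr
    rw [hε, ENNReal.mul_inv (by simp) (by simp), mul_assoc]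
    refine mul_le_of_le_one_right' ?_
    exact (mul_le_mul' le_rfl le_self_add).trans (ENNReal.inv_mul_le_one _)
  have h2 : N / 2 + N / 2 ≤ N / 2 + c⁻¹ * (Cρ * ∫⁻ z in G, ‖g z‖ₑ ^ 2 ∂(weightedArea α)) := by
    rw [ENNReal.add_halves]
    exact hmain.trans (add_le_add hhalf le_rfl)
  have h3 := (ENNReal.add_le_add_iff_left (ENNReal.div_lt_top hfin (by norm_num)).ne).1 h2
  calc N = 2 * (N / 2) := (ENNReal.mul_div_cancel (by norm_num) (by norm_num)).symm
    _ ≤ 2 * (c⁻¹ * (Cρ * ∫⁻ z in G, ‖g z‖ₑ ^ 2 ∂(weightedArea α))) := by gcongr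
    _ = _ := by ring

/-! ### Toeplitz operators with nonnegative symbol -/

theorem exists_ae_norm_le {α : ℝ} {φ : ℂ → ℝ} (hφ : MemLp φ ∞ (weightedArea α)) :
    ∃ L : ℝ, 0 < L ∧ ∀ᵐ z ∂(weightedArea α), ‖φ z‖ ≤ L := by
  refine ⟨(eLpNormEssSup φ (weightedArea α)).toReal + 1, by positivity, ?_⟩
  have htop : eLpNormEssSup φ (weightedArea α) ≠ ∞ := by
    rw [← eLpNorm_exponent_top]
    exact hφ.2.ne
  filter_upwards [ae_le_eLpNormEssSup (f := φ) (μ := weightedArea α)] with z hz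
  have h := ENNReal.toReal_mono htop hz
  rw [toReal_enorm] at h
  linarith

theorem integrable_norm_sq {α : ℝ} (f : Lp ℂ 2 (weightedArea α)) :
    Integrable (fun z => ‖f z‖ ^ 2) (weightedArea α) :=
  (memLp_two_iff_integrable_sq_norm (Lp.aestronglyMeasurable f)).1 (Lp.memLp f)

theorem integrable_norm_sq_mul {α : ℝ} {φ : ℂ → ℝ} (hφ : MemLp φ ∞ (weightedArea α))
    (f : Lp ℂ 2 (weightedArea α)) :
    Integrable (fun z => ‖f z‖ ^ 2 * φ z) (weightedArea α) := by
  obtain ⟨L, -, hL⟩ := exists_ae_norm_le hφ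
  exact (integrable_norm_sq f).mul_bdd hφ.1 hL

theorem norm_sq_eq_integral {α : ℝ} (f : Lp ℂ 2 (weightedArea α)) :
    ‖f‖ ^ 2 = ∫ z, ‖f z‖ ^ 2 ∂(weightedArea α) := by
  have h : ((‖f‖ ^ 2 : ℝ) : ℂ) = ((∫ z, ‖f z‖ ^ 2 ∂(weightedArea α) : ℝ) : ℂ) := by
    have h1 := inner_self_eq_norm_sq_to_K (𝕜 := ℂ) f
    rw [L2.inner_def] at h1
    push_cast
    refine h1.symm.trans ?_
    rw [← integral_complex_ofReal]
    refine integral_congr_ae (Eventually.of_forall fun z => ?_)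
    simp only [inner_self_eq_norm_sq_to_K]
    push_cast
    rfl
  exact_mod_cast h

theorem mulOperator_coeFn {α : ℝ} {φ : ℂ → ℂ} (hφ : MemLp φ ∞ (weightedArea α))
    (f : Lp ℂ 2 (weightedArea α)) :
    mulOperator α φ hφ f =ᵐ[weightedArea α] fun z => φ z * f z := by
  have h1 := (ContinuousLinearMap.mul ℂ ℂ).coeFn_holder (r := 2) (hφ.toLp φ) f
  filter_upwards [h1, hφ.coeFn_toLp] with z hz1 hz2
  rw [mulOperator, ContinuousLinearMap.holderL_apply_apply, hz1, hz2]
  rfl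

/-- The quadratic form of `T_φ` is `∫ |f|² φ ω_α dA`. -/
theorem inner_toeplitz {α : ℝ} {φ : ℂ → ℝ} (hφ : MemLp φ ∞ (weightedArea α))
    (f : harmonicBergman α) :
    inner ℂ (toeplitz α (fun z => (φ z : ℂ)) hφ.ofReal f) f =
      ((∫ z, ‖(f : Lp ℂ 2 (weightedArea α)) z‖ ^ 2 * φ z ∂(weightedArea α) : ℝ) : ℂ) := by
  rw [toeplitz]
  simp only [ContinuousLinearMap.comp_apply, Submodule.subtypeL_apply]
  refine (Submodule.inner_orthogonalProjectionOnto_eq_of_mem_right f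
    (mulOperator α (fun z => (φ z : ℂ)) hφ.ofReal f)).trans ?_
  rw [L2.inner_def, ← integral_complex_ofReal]
  refine integral_congr_ae ?_
  filter_upwards [mulOperator_coeFn (φ := fun z => (φ z : ℂ)) hφ.ofReal
    (f : Lp ℂ 2 (weightedArea α))] with z hz
  rw [hz, RCLike.inner_apply]
  simp only [map_mul, Complex.conj_ofReal]
  rw [mul_left_comm, Complex.mul_conj, Complex.normSq_eq_norm_sq]
  push_cast
  ring

/-- `‖T_φ f‖² ≤ L ⟨T_φ f, f⟩` if `0 ≤ φ ≤ L`. -/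
theorem norm_toeplitz_sq_le {α : ℝ} {φ : ℂ → ℝ} (hφ : MemLp φ ∞ (weightedArea α))
    (hφ0 : ∀ᵐ z ∂(weightedArea α), 0 ≤ φ z) {L : ℝ}
    (hL : ∀ᵐ z ∂(weightedArea α), ‖φ z‖ ≤ L) (f : harmonicBergman α) :
    ‖toeplitz α (fun z => (φ z : ℂ)) hφ.ofReal f‖ ^ 2 ≤
      L * ∫ z, ‖(f : Lp ℂ 2 (weightedArea α)) z‖ ^ 2 * φ z ∂(weightedArea α) := by
  have h1 : ‖toeplitz α (fun z => (φ z : ℂ)) hφ.ofReal f‖ ≤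
      ‖mulOperator α (fun z => (φ z : ℂ)) hφ.ofReal (f : Lp ℂ 2 (weightedArea α))‖ := by
    rw [toeplitz]
    simp only [ContinuousLinearMap.comp_apply, Submodule.subtypeL_apply]
    exact Submodule.norm_orthogonalProjectionOnto_apply_le _ _
  refine (pow_le_pow_left₀ (norm_nonneg _) h1 2).trans ?_
  rw [norm_sq_eq_integral, ← integral_const_mul]
  refine integral_mono_ae (integrable_norm_sq _) ((integrable_norm_sq_mul hφ _).const_mul L) ?_
  filter_upwards [mulOperator_coeFn (φ := fun z => (φ z : ℂ)) hφ.ofReal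
    (f : Lp ℂ 2 (weightedArea α)), hφ0, hL]
    with z hz h0 hzL
  rw [Real.norm_eq_abs, abs_of_nonneg h0] at hzL
  rw [hz, norm_mul, mul_pow]
  simp only [Complex.norm_real, Real.norm_eq_abs, sq_abs]
  nlinarith [mul_nonneg (mul_nonneg h0 (sub_nonneg.2 hzL))
    (sq_nonneg ‖(f : Lp ℂ 2 (weightedArea α)) z‖)]

theorem isUnit_toeplitz_iff {α : ℝ} {φ : ℂ → ℝ} (hφ : MemLp φ ∞ (weightedArea α))
    (hφ0 : ∀ᵐ z ∂(weightedArea α), 0 ≤ φ z) :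
    IsUnit (toeplitz α (fun z => (φ z : ℂ)) hφ.ofReal) ↔
      ∃ C : ℝ, 0 < C ∧ ∀ f : Lp ℂ 2 (weightedArea α), f ∈ harmonicBergman α →
        C * ∫ z, ‖f z‖ ^ 2 ∂(weightedArea α) ≤ ∫ z, ‖f z‖ ^ 2 * φ z ∂(weightedArea α) := by
  have hnonneg : ∀ f : Lp ℂ 2 (weightedArea α), 0 ≤ ∫ z, ‖f z‖ ^ 2 * φ z ∂(weightedArea α) := by
    intro f
    refine integral_nonneg_of_ae ?_
    filter_upwards [hφ0] with z hz using mul_nonneg (sq_nonneg _) hz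
  constructor
  · rintro ⟨u, hu⟩
    obtain ⟨L, hL0, hL⟩ := exists_ae_norm_le hφ
    set S : harmonicBergman α →L[ℂ] harmonicBergman α := ↑u⁻¹ with hS
    set D := ‖S‖ ^ 2 * L + 1 with hD
    have hD0 : 0 < D := by positivity
    refine ⟨D⁻¹, inv_pos.2 hD0, fun f hf => ?_⟩
    rw [inv_mul_le_iff₀ hD0, ← norm_sq_eq_integral]
    have h1 : S (toeplitz α (fun z => (φ z : ℂ)) hφ.ofReal ⟨f, hf⟩) = ⟨f, hf⟩ := by
      rw [← hu, hS, ← mul_apply_eq_comp, Units.inv_mul, one_apply_eq_self]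
    have h2 := S.le_opNorm (toeplitz α (fun z => (φ z : ℂ)) hφ.ofReal ⟨f, hf⟩)
    rw [h1] at h2
    have h3 := norm_toeplitz_sq_le hφ hφ0 hL ⟨f, hf⟩
    have h4 := hnonneg f
    calc ‖f‖ ^ 2 ≤ (‖S‖ * ‖toeplitz α (fun z => (φ z : ℂ)) hφ.ofReal ⟨f, hf⟩‖) ^ 2 :=
          pow_le_pow_left₀ (norm_nonneg _) h2 2
      _ = ‖S‖ ^ 2 * ‖toeplitz α (fun z => (φ z : ℂ)) hφ.ofReal ⟨f, hf⟩‖ ^ 2 := mul_pow _ _ _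
      _ ≤ ‖S‖ ^ 2 * (L * ∫ z, ‖f z‖ ^ 2 * φ z ∂(weightedArea α)) := by gcongr
      _ ≤ D * ∫ z, ‖f z‖ ^ 2 * φ z ∂(weightedArea α) := by
          rw [hD]
          linarith
  · rintro ⟨C, hC, h⟩
    refine ContinuousLinearMap.isUnit_of_forall_le_norm_inner_map _ (c := ⟨C, hC.le⟩) hC
      fun f => ?_
    rw [inner_toeplitz hφ f, Complex.norm_real, Real.norm_eq_abs, abs_of_nonneg (hnonneg _)]
    have h1 := h f f.2
    rw [← norm_sq_eq_integral] at h1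
    rw [mul_comm]
    exact h1

/-! ### The Berezin transform -/

theorem aestronglyMeasurable_berezin {α : ℝ} (hα : -1 < α) {φ : ℂ → ℝ}
    (hφ : AEStronglyMeasurable φ (weightedArea α)) :
    AEStronglyMeasurable (berezin α φ) (weightedArea α) := by
  have := isProbabilityMeasure_weightedArea hα
  have h1 : ∀ z, ∫ w, φ w * ‖harmonicKernel α z w‖ ^ 2 ∂(weightedArea α) =
      ∫ w, hφ.mk φ w * ‖harmonicKernel α z w‖ ^ 2 ∂(weightedArea α) := by
    intro z
    refine integral_congr_ae ?_
    filter_upwards [hφ.ae_eq_mk] with w hw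
    rw [hw]
  have h2 : StronglyMeasurable fun z =>
      ∫ w, hφ.mk φ w * ‖harmonicKernel α z w‖ ^ 2 ∂(weightedArea α) :=
    StronglyMeasurable.integral_prod_right
      (f := fun z w => hφ.mk φ w * ‖harmonicKernel α z w‖ ^ 2)
      ((hφ.stronglyMeasurable_mk.measurable.comp measurable_snd).mul
        ((measurable_harmonicKernel_uncurry α).norm.pow_const 2)).stronglyMeasurable
  have h3 : berezin α φ = fun z => 1 / harmonicKernelNormSq α z *
      ∫ w, hφ.mk φ w * ‖harmonicKernel α z w‖ ^ 2 ∂(weightedArea α) := by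
    ext z
    rw [berezin, h1]
  rw [h3]
  exact ((measurable_const.div (measurable_harmonicKernelNormSq hα)).mul
    h2.measurable).aestronglyMeasurable

theorem integrable_norm_harmonicKernel_sq {α : ℝ} (hα : -1 < α) {z : ℂ}
    (hz : z ∈ Metric.ball (0 : ℂ) 1) :
    Integrable (fun w => ‖harmonicKernel α z w‖ ^ 2) (weightedArea α) :=
  (memLp_two_iff_integrable_sq_norm (measurable_harmonicKernel α z).aestronglyMeasurable).1
    (memLp_harmonicKernel hα hz 2)

theorem berezin_nonneg {α : ℝ} {φ : ℂ → ℝ} (hφ0 : ∀ᵐ z ∂(weightedArea α), 0 ≤ φ z) (z : ℂ) :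
    0 ≤ berezin α φ z := by
  refine mul_nonneg (one_div_nonneg.2 (integral_nonneg fun w => sq_nonneg _))
    (integral_nonneg_of_ae ?_)
  filter_upwards [hφ0] with w hw using mul_nonneg hw (sq_nonneg _)

theorem berezin_le {α : ℝ} (hα : -1 < α) {φ : ℂ → ℝ} (hφ : MemLp φ ∞ (weightedArea α)) {L : ℝ}
    (hL : ∀ᵐ z ∂(weightedArea α), ‖φ z‖ ≤ L) {z : ℂ} (hz : z ∈ Metric.ball (0 : ℂ) 1) :
    berezin α φ z ≤ L := by
  have hN := harmonicKernelNormSq_pos hα hz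
  have hi := integrable_norm_harmonicKernel_sq hα hz
  rw [berezin, one_div, inv_mul_le_iff₀ hN, harmonicKernelNormSq, mul_comm _ L,
    ← integral_const_mul]
  refine integral_mono_ae (hi.bdd_mul hφ.1 hL) (hi.const_mul L) ?_
  filter_upwards [hL] with w hw
  exact mul_le_mul_of_nonneg_right ((le_abs_self _).trans hw) (sq_nonneg _)

/-- Testing the lower bound for the quadratic form of `T_φ` on the reproducing kernels bounds the
Berezin transform from below. -/
theorem le_berezin {α : ℝ} (hα : -1 < α) {φ : ℂ → ℝ} {C : ℝ}
    (h : ∀ f : Lp ℂ 2 (weightedArea α), f ∈ harmonicBergman α →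
      C * ∫ z, ‖f z‖ ^ 2 ∂(weightedArea α) ≤ ∫ z, ‖f z‖ ^ 2 * φ z ∂(weightedArea α))
    {z : ℂ} (hz : z ∈ Metric.ball (0 : ℂ) 1) : C ≤ berezin α φ z := by
  have hm := memLp_harmonicKernel hα hz 2
  have hN := harmonicKernelNormSq_pos hα hz
  have h1 := h (hm.toLp _) ⟨harmonicKernel α z, harmonicKernel_harmonic α hz, hm.coeFn_toLp⟩
  have e1 : ∫ w, ‖hm.toLp (harmonicKernel α z) w‖ ^ 2 ∂(weightedArea α) =
      harmonicKernelNormSq α z := by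
    refine integral_congr_ae ?_
    filter_upwards [hm.coeFn_toLp] with w hw
    rw [hw]
  have e2 : ∫ w, ‖hm.toLp (harmonicKernel α z) w‖ ^ 2 * φ w ∂(weightedArea α) =
      ∫ w, φ w * ‖harmonicKernel α z w‖ ^ 2 ∂(weightedArea α) := by
    refine integral_congr_ae ?_
    filter_upwards [hm.coeFn_toLp] with w hw
    rw [hw, mul_comm]
  rw [e1, e2] at h1
  rw [berezin, one_div, le_inv_mul_iff₀ hN]
  linarith

theorem isInvertibleLInfty_berezin {α : ℝ} (hα : -1 < α) {φ : ℂ → ℝ}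
    (hφ : MemLp φ ∞ (weightedArea α)) (hφ0 : ∀ᵐ z ∂(weightedArea α), 0 ≤ φ z) {C : ℝ}
    (hC : 0 < C) (h : ∀ z ∈ Metric.ball (0 : ℂ) 1, C ≤ berezin α φ z) :
    IsInvertibleLInfty α (berezin α φ) := by
  obtain ⟨L, -, hL⟩ := exists_ae_norm_le hφ
  have hm := aestronglyMeasurable_berezin hα hφ.1
  refine ⟨memLp_top_of_bound hm L ?_, fun z => (berezin α φ z)⁻¹,
    memLp_top_of_bound hm.aemeasurable.inv.aestronglyMeasurable C⁻¹ ?_, ?_⟩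
  · filter_upwards [ae_mem_ball α] with z hz
    rw [Real.norm_eq_abs, abs_of_nonneg (berezin_nonneg hφ0 z)]
    exact berezin_le hα hφ hL hz
  · filter_upwards [ae_mem_ball α] with z hz
    rw [norm_inv, Real.norm_eq_abs, abs_of_nonneg (berezin_nonneg hφ0 z)]
    exact inv_anti₀ hC (h z hz)
  · filter_upwards [ae_mem_ball α] with z hz
    exact mul_inv_cancel₀ (hC.trans_le (h z hz)).ne'

theorem exists_le_berezin {α : ℝ} {φ : ℂ → ℝ} (hφ0 : ∀ᵐ z ∂(weightedArea α), 0 ≤ φ z)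
    (h : IsInvertibleLInfty α (berezin α φ)) :
    ∃ c : ℝ, 0 < c ∧ ∀ᵐ z ∂(weightedArea α), c ≤ berezin α φ z := by
  obtain ⟨-, η, hη, h1⟩ := h
  obtain ⟨L, hL0, hL⟩ := exists_ae_norm_le hη
  refine ⟨L⁻¹, inv_pos.2 hL0, ?_⟩
  filter_upwards [h1, hL] with z hz1 hz2
  have h2 := berezin_nonneg hφ0 z
  rw [inv_le_iff_one_le_mul₀ hL0, ← hz1]
  exact mul_le_mul_of_nonneg_left ((le_abs_self _).trans hz2) h2

/-- The Berezin transform is dominated by the average of `φ` against the normalised analytic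
kernels `|k_z|²`. -/
theorem berezin_le_integral_kernelDensity {α : ℝ} (hα : -1 < α) {φ : ℂ → ℝ}
    (hφ : MemLp φ ∞ (weightedArea α)) (hφ0 : ∀ᵐ z ∂(weightedArea α), 0 ≤ φ z) {z : ℂ}
    (hz : z ∈ Metric.ball (0 : ℂ) 1) :
    berezin α φ z ≤
      (2 + 2 ^ (2 + α)) ^ 2 * ∫ w, φ w * kernelDensity α z w ∂(weightedArea α) := by
  obtain ⟨L, -, hL⟩ := exists_ae_norm_le hφ
  have hN := harmonicKernelNormSq_pos hα hz
  set s := ((1 - ‖z‖ ^ 2) ^ (2 + α))⁻¹ with hs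
  set B : ℝ := (2 + 2 ^ (2 + α)) ^ 2 with hB
  have hI : 0 ≤ B * ∫ w, φ w * kernelDensity α z w ∂(weightedArea α) := by
    refine mul_nonneg (by positivity) (integral_nonneg_of_ae ?_)
    filter_upwards [hφ0] with w hw using mul_nonneg hw (kernelDensity_nonneg α hz w)
  rw [berezin, one_div, inv_mul_le_iff₀ hN]
  calc ∫ w, φ w * ‖harmonicKernel α z w‖ ^ 2 ∂(weightedArea α)
      ≤ ∫ w, (s * B) * (φ w * kernelDensity α z w) ∂(weightedArea α) := by
        refine integral_mono_ae ((integrable_norm_harmonicKernel_sq hα hz).bdd_mul hφ.1 hL)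
          (((integral_kernelDensity hα hz).1.bdd_mul hφ.1 hL).const_mul _) ?_
        filter_upwards [ae_mem_ball α, hφ0] with w hw h0
        have := mul_le_mul_of_nonneg_left (norm_harmonicKernel_sq_le hα hz hw) h0
        rw [← hs, ← hB] at this
        linarith
    _ = s * (B * ∫ w, φ w * kernelDensity α z w ∂(weightedArea α)) := by
        rw [integral_const_mul, mul_assoc]
    _ ≤ _ := mul_le_mul_of_nonneg_right (inv_le_harmonicKernelNormSq hα hz) hI

/-- If the Berezin transform is bounded below, then some superlevel set of `φ` carries a fixed
amount of the image of `ω_α dA` under almost every `moebius z`. -/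
theorem exists_le_measure_preimage_moebius {α : ℝ} (hα : -1 < α) {φ : ℂ → ℝ}
    (hφ : MemLp φ ∞ (weightedArea α)) (hφ0 : ∀ᵐ z ∂(weightedArea α), 0 ≤ φ z) {c : ℝ}
    (hc : 0 < c) (h : ∀ᵐ z ∂(weightedArea α), c ≤ berezin α φ z) :
    ∃ r : ℝ, 0 < r ∧ ∃ δ : ℝ≥0∞, 0 < δ ∧ ∀ G : Set ℂ, MeasurableSet G →
      (∀ᵐ z ∂(weightedArea α), r < φ z → z ∈ G) →
      ∀ᵐ z ∂(weightedArea α), δ ≤ weightedArea α (moebius z ⁻¹' G) := by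
  obtain ⟨L, hL0, hL⟩ := exists_ae_norm_le hφ
  set B : ℝ := (2 + 2 ^ (2 + α)) ^ 2 with hB
  have hB0 : 0 < B := by positivity
  -- the part of `φ` below this level accounts for at most half of the lower bound `c`
  refine ⟨c / (2 * B), by positivity, ENNReal.ofReal (c / (2 * B * L)), ?_, fun G hG hφG => ?_⟩
  · rw [ENNReal.ofReal_pos]
    positivity
  filter_upwards [h, ae_mem_ball α] with z hz hzb
  obtain ⟨hki, hk1⟩ := integral_kernelDensity hα hzb
  have h1 : ∫ w, φ w * kernelDensity α z w ∂(weightedArea α) ≤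
      c / (2 * B) + L * ∫ w in G, kernelDensity α z w ∂(weightedArea α) := by
    calc ∫ w, φ w * kernelDensity α z w ∂(weightedArea α)
        ≤ ∫ w, (c / (2 * B) * kernelDensity α z w + L * G.indicator (kernelDensity α z) w)
            ∂(weightedArea α) := by
          refine integral_mono_ae (hki.bdd_mul hφ.1 hL)
            ((hki.const_mul _).add ((hki.indicator hG).const_mul L)) ?_
          filter_upwards [hL, hφG] with w hw hwG
          have hk0 := kernelDensity_nonneg α hzb w
          by_cases hGw : w ∈ G
          · simp only [Set.indicator_of_mem hGw]
            have := mul_le_mul_of_nonneg_right ((le_abs_self _).trans hw) hk0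
            have : 0 ≤ c / (2 * B) * kernelDensity α z w := by positivity
            linarith
          · simp only [Set.indicator_of_notMem hGw, mul_zero, add_zero]
            exact mul_le_mul_of_nonneg_right (not_lt.1 fun hlt => hGw (hwG hlt)) hk0
      _ = _ := by
          rw [integral_add (hki.const_mul _) ((hki.indicator hG).const_mul L),
            integral_const_mul, integral_const_mul, hk1, integral_indicator hG, mul_one]
  have h2 := hz.trans (berezin_le_integral_kernelDensity hα hφ hφ0 hzb)
  rw [← hB] at h2
  have h3 : c / (2 * B * L) ≤ ∫ w in G, kernelDensity α z w ∂(weightedArea α) := by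
    have h4 := h2.trans (mul_le_mul_of_nonneg_left h1 hB0.le)
    rw [div_le_iff₀ (by positivity)]
    have h5 : B * (c / (2 * B)) = c / 2 := by field_simp
    nlinarith
  have h6 : weightedArea α (moebius z ⁻¹' G) =
      ENNReal.ofReal (∫ w in G, kernelDensity α z w ∂(weightedArea α)) := by
    rw [ofReal_integral_eq_lintegral_ofReal hki.integrableOn
      (Eventually.of_forall fun w => kernelDensity_nonneg α hzb w),
      ← lintegral_indicator_one (measurable_moebius z hG), ← lintegral_indicator hG]
    refine (lintegral_comp_moebius hα hzb (G.indicator 1)).trans (lintegral_congr fun w => ?_)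
    by_cases hGw : w ∈ G <;> simp [hGw]
  rw [h6]
  exact ENNReal.ofReal_le_ofReal h3

theorem integral_norm_sq_eq_toReal {ν : Measure ℂ} {f : ℂ → ℂ} (hf : AEStronglyMeasurable f ν) :
    ∫ z, ‖f z‖ ^ 2 ∂ν = (∫⁻ z, ‖f z‖ₑ ^ 2 ∂ν).toReal := by
  rw [integral_eq_lintegral_of_nonneg_ae (Eventually.of_forall fun z => sq_nonneg _)
    (hf.norm.pow 2)]
  congr 1
  refine lintegral_congr fun z => ?_
  rw [ENNReal.ofReal_pow (norm_nonneg _), ofReal_norm]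

theorem isReverseCarleson_of_thick {α : ℝ} (hα : -1 < α) {G : Set ℂ} (hG : MeasurableSet G)
    {δ : ℝ≥0∞} (hδ : 0 < δ)
    (hthick : ∀ᵐ z ∂(weightedArea α), δ ≤ weightedArea α (moebius z ⁻¹' G)) :
    IsReverseCarleson α G := by
  obtain ⟨C, hC, h⟩ := exists_lintegral_le_setLIntegral hα hG hδ hthick
  refine ⟨C.toReal + 1, by positivity, ?_⟩
  rintro f ⟨g, hg, hfg⟩
  have e : (fun z => ‖f z‖ₑ ^ 2) =ᵐ[weightedArea α] fun z => ‖g z‖ₑ ^ 2 := by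
    filter_upwards [hfg] with z hz
    rw [hz]
  have hfin : ∫⁻ z, ‖f z‖ₑ ^ 2 ∂(weightedArea α) ≠ ∞ := by
    have := (integrable_norm_sq f).lintegral_lt_top.ne
    refine ne_of_eq_of_ne (lintegral_congr fun z => ?_) this
    rw [ENNReal.ofReal_pow (norm_nonneg _), ofReal_norm]
  have h1 := h g hg (by rwa [← lintegral_congr_ae e])
  rw [← lintegral_congr_ae e, ← lintegral_congr_ae (ae_restrict_of_ae e)] at h1
  have hfinG : ∫⁻ z in G, ‖f z‖ₑ ^ 2 ∂(weightedArea α) ≠ ∞ :=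
    ((setLIntegral_le_lintegral G _).trans_lt hfin.lt_top).ne
  have h2 := ENNReal.toReal_mono (ENNReal.mul_ne_top hC hfinG) h1
  have hfm := Lp.aestronglyMeasurable f
  rw [ENNReal.toReal_mul, ← integral_norm_sq_eq_toReal hfm,
    ← integral_norm_sq_eq_toReal hfm.restrict] at h2
  have h3 : 0 ≤ ∫ z in G, ‖f z‖ ^ 2 ∂(weightedArea α) := integral_nonneg fun z => sq_nonneg _
  linarith

theorem isReverseCarleson_congr {α : ℝ} {G G' : Set ℂ} (h : G =ᵐ[weightedArea α] G') :
    IsReverseCarleson α G ↔ IsReverseCarleson α G' := by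
  rw [IsReverseCarleson, IsReverseCarleson, Measure.restrict_congr_set h]

theorem exists_isReverseCarleson {α : ℝ} (hα : -1 < α) {φ : ℂ → ℝ}
    (hφ : MemLp φ ∞ (weightedArea α)) (hφ0 : ∀ᵐ z ∂(weightedArea α), 0 ≤ φ z)
    (h : IsInvertibleLInfty α (berezin α φ)) :
    ∃ r : ℝ, 0 < r ∧ IsReverseCarleson α {z | z ∈ Metric.ball (0 : ℂ) 1 ∧ r < φ z} := by
  obtain ⟨c, hc, hcb⟩ := exists_le_berezin hφ0 h
  obtain ⟨r, hr, δ, hδ, hG⟩ := exists_le_measure_preimage_moebius hα hφ hφ0 hc hcb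
  refine ⟨r, hr, ?_⟩
  -- `φ` is only almost everywhere measurable, so its superlevel set is replaced by a measurable one
  set G : Set ℂ := {z | r < hφ.1.mk φ z} with hGdef
  have hGm : MeasurableSet G :=
    measurableSet_lt measurable_const hφ.1.stronglyMeasurable_mk.measurable
  have heq : ({z | z ∈ Metric.ball (0 : ℂ) 1 ∧ r < φ z} : Set ℂ) =ᵐ[weightedArea α] G := by
    rw [eventuallyEq_set]
    filter_upwards [ae_mem_ball α, hφ.1.ae_eq_mk] with z hz hzeq
    simp only [hGdef, Set.mem_ofPred_eq, ← hzeq]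
    exact and_iff_right hz
  rw [isReverseCarleson_congr heq]
  refine isReverseCarleson_of_thick hα hGm hδ (hG G hGm ?_)
  filter_upwards [hφ.1.ae_eq_mk] with z hzeq hz
  rwa [hzeq] at hz

theorem exists_le_of_isReverseCarleson {α : ℝ} {φ : ℂ → ℝ}
    (hφ : MemLp φ ∞ (weightedArea α)) (hφ0 : ∀ᵐ z ∂(weightedArea α), 0 ≤ φ z) {r : ℝ}
    (hr : 0 < r) (h : IsReverseCarleson α {z | z ∈ Metric.ball (0 : ℂ) 1 ∧ r < φ z}) :
    ∃ C : ℝ, 0 < C ∧ ∀ f : Lp ℂ 2 (weightedArea α), f ∈ harmonicBergman α →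
      C * ∫ z, ‖f z‖ ^ 2 ∂(weightedArea α) ≤ ∫ z, ‖f z‖ ^ 2 * φ z ∂(weightedArea α) := by
  obtain ⟨C, hC, hG⟩ := h
  set G : Set ℂ := {z | z ∈ Metric.ball (0 : ℂ) 1 ∧ r < φ z} with hGdef
  have hGm : NullMeasurableSet G (weightedArea α) :=
    Metric.isOpen_ball.measurableSet.nullMeasurableSet.inter
      (nullMeasurableSet_lt aemeasurable_const hφ.1.aemeasurable)
  refine ⟨r / C, by positivity, fun f hf => ?_⟩
  have h1 : r * ∫ z in G, ‖f z‖ ^ 2 ∂(weightedArea α) ≤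
      ∫ z, ‖f z‖ ^ 2 * φ z ∂(weightedArea α) := by
    rw [← integral_const_mul]
    refine le_trans (setIntegral_mono_ae_restrict ((integrable_norm_sq f).const_mul r).integrableOn
      (integrable_norm_sq_mul hφ f).integrableOn ?_)
      (setIntegral_le_integral (integrable_norm_sq_mul hφ f) ?_)
    · rw [EventuallyLE, ae_restrict_iff'₀ hGm]
      refine Eventually.of_forall fun z hz => ?_
      rw [mul_comm]
      exact mul_le_mul_of_nonneg_left hz.2.le (sq_nonneg _)
    · filter_upwards [hφ0] with z hz using mul_nonneg (sq_nonneg _) hz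
  rw [div_mul_eq_mul_div, div_le_iff₀ hC]
  have h2 := mul_le_mul_of_nonneg_left (hG f hf) hr.le
  nlinarith

end HarmonicBergman

open HarmonicBergman
theorem mainTheorem7 (α : ℝ) (hα : -1 < α) (φ : ℂ → ℝ)
    (hφ : MemLp φ ⊤ (weightedArea α))
    (hφ0 : ∀ᵐ z ∂(weightedArea α), 0 ≤ φ z) :
    (∀ z ∈ Metric.ball (0 : ℂ) 1,
      (harmonicKernelNormSq α z : ℂ) = harmonicKernel α z z ∧
      harmonicKernelNormSq α z = 2 / (1 - ‖z‖ ^ 2) ^ (2 + α) - 1) ∧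
    List.TFAE [
      IsUnit (toeplitz α (fun z => (φ z : ℂ)) hφ.ofReal),
      IsInvertibleLInfty α (berezin α φ),
      ∃ r : ℝ, 0 < r ∧ IsReverseCarleson α {z | z ∈ Metric.ball (0 : ℂ) 1 ∧ r < φ z},
      ∃ C : ℝ, 0 < C ∧ ∀ f : Lp ℂ 2 (weightedArea α),
        f ∈ harmonicBergman α →
          C * ∫ z, ‖f z‖ ^ 2 ∂(weightedArea α) ≤
            ∫ z, ‖f z‖ ^ 2 * φ z ∂(weightedArea α)] := by
  refine ⟨fun z hz => ⟨?_, harmonicKernelNormSq_eq hα hz⟩, ?_⟩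
  · rw [harmonicKernel_self hz, harmonicKernelNormSq_eq hα hz]
  tfae_have 1 ↔ 4 := isUnit_toeplitz_iff hφ hφ0
  tfae_have 4 → 2 := fun ⟨_, hC, h⟩ =>
    isInvertibleLInfty_berezin hα hφ hφ0 hC fun _ hz => le_berezin hα h hz
  tfae_have 2 → 3 := exists_isReverseCarleson hα hφ hφ0
  tfae_have 3 → 4 := fun ⟨_, hr, h⟩ => exists_le_of_isReverseCarleson hφ hφ0 hr h
  tfae_finish
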